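/- **Lemma (Lorentz–Besov compensation for multi-commutators).** Notation. For a function $f$ on $\mathbb R$ with values in a normed space let $f^*(\tau)=\inf\{\lambda\ge 0: |\{\|f\|>\lambda\}|\le\tau\}$ be its decreasing rearrangement, and for $1<p<\infty$, $t\in[1,\infty]$ let $\|f\|_{L^{p,t}}=\big(\int_0^\infty(\tau^{1/p}f^*(\tau))^t\,\frac{d\tau}{\tau}\big)^{1/t}$ (for $t=\infty$: $\sup_{\tau>0}\tau^{1/p}f^*(\tau)$). For $q\in[1,\infty]$ let $q'$ denote the conjugate exponent. With the usual modification when the integral exponent is $\infty$ (then $2/q:=0$ below), put $$\|K\|_{A^{\varsigma}_{(p,t),q}}=\Big(\int_{\mathbb R}|h|^{1-q\varsigma}\,\|K(\cdot,\cdot+h)\|^q_{L^{p,t}(\mathbb R)}\,dh\Big)^{1/q}$$ for $\varsigma\in\mathbb R$ and kernels $K:\mathbb R^2\to M_m(\mathbb R)$ ($M_m(\mathbb R)$ with the Frobenius norm), and, for $0<s<1$ and $\varphi:\mathbb R\to\mathbb R^m$, $$\|\varphi\|_{\dot B^{s}_{(p,t),q}}=\Big(\int_{\mathbb R}|h|^{-1-sq}\,\|\varphi(\cdot+h)-\varphi\|^q_{L^{p,t}(\mathbb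 R)}\,dh\Big)^{1/q}.$$ The norm of the homogeneous Lorentz–Besov space of negative order is the dual one: for a tempered distribution $T$ with values in $\mathbb R^m$, $$\|T\|_{\dot B^{-s}_{(p,t),q}}=\sup\big\{|\langle T,\varphi\rangle| : \varphi\in\mathcal S(\mathbb R,\mathbb R^m),\ \|\varphi\|_{\dot B^{s}_{(p',t'),q'}}\le 1\big\}.$$ Statement. Let $1<r<\infty$, $r'<p<\infty$, $2\le q\le\infty$, $\sigma>0$, $t\in[1,\infty]$, and assume that $s:=\frac2q-1+\sigma$ satisfies $0<s<1$. There is a constant $C$, depending only on $r,p,q,\sigma,t$, with the following property. Let $m\ge 0$, let $K\in L^1_{loc}(\mathbb R^2,M_m(\mathbb R))$ be anti-self-dual, i.e. $K(x,y)=-K^t(y,x)$ for a.e. $(x,y)$, with $\|K\|_{A^{-\sigma}_{(p,t),q}}<\infty$, and let $v\in L^{r,\infty}(\mathbb R,\mathbb R^m)$. Then the multi-commutator $$\mathcal T_K(v)(x)=\int_{\mathbb R}\big[K^t(x,y)\,v(x)+K(x,y)\,v(y)\big]\,dy$$ is well defined as a tempered distribution, in the following principal-value sense: for every $\varepsilon>0$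 the integral over $\{y:|x-y|>\varepsilon\}$ converges absolutely for a.e. $x$ and defines a function whose product with every $\varphi\in\mathcal S(\mathbb R,\mathbb R^m)$ is integrable, and these functions converge, tested against every such $\varphi$, to $\langle\mathcal T_K(v),\varphi\rangle$ as $\varepsilon\to0^+$. Moreover $$\|\mathcal T_K(v)\|_{\dot B^{-(2/q-1+\sigma)}_{(rp/(p+r),\,t),\,q}}\le C\,\|K\|_{A^{-\sigma}_{(p,t),q}}\,\|v\|_{L^{r,\infty}}.$$ -/

import Mathlib

open MeasureTheory Filter Topology Set
open scoped ENNReal NNReal Matrix SchwartzMap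

attribute [local instance] Matrix.frobeniusNormedAddCommGroup

noncomputable section

/-- Euclidean space `ℝᵐ`. -/
abbrev Vec (m : ℕ) : Type := EuclideanSpace ℝ (Fin m)

/-- Real `m × m` matrices, normed by the Frobenius norm. -/
abbrev Mat (m : ℕ) : Type := Matrix (Fin m) (Fin m) ℝ

/-! ### Lorentz spaces -/

/-- The decreasing rearrangement `f^*(τ) = inf {l ≥ 0 : |{x : ‖f x‖ > l}| ≤ τ}` of a function
on the line. -/
def decRearr {E : Type*} [NormedAddCommGroup E] (f : ℝ → E) (τ : ℝ) : ℝ≥0∞ :=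
  sInf {l : ℝ≥0∞ | volume {x : ℝ | l < ‖f x‖ₑ} ≤ ENNReal.ofReal τ}

/-- The measure `dτ / τ` on `(0, ∞)`. -/
def haarPos : Measure ℝ :=
  (volume.restrict (Ioi (0 : ℝ))).withDensity fun τ => ENNReal.ofReal τ⁻¹

/-- The Lorentz (quasi-)norm of `L^{p,t}(ℝ)`, that is
`(∫₀^∞ (τ^{1/p} f^*(τ))^t dτ/τ)^{1/t}`, and `sup_{τ > 0} τ^{1/p} f^*(τ)` for `t = ∞`. -/
def lorentzNorm {E : Type*} [NormedAddCommGroup E] (p : ℝ) (t : ℝ≥0∞) (f : ℝ → E) : ℝ≥0∞ :=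
  eLpNorm (fun τ : ℝ => ENNReal.ofReal τ ^ (1 / p) * decRearr f τ) t haarPos

/-! ### Lorentz-Besov spaces of kernels -/

/-- The norm of `A^s_{(p,t),q}(ℝ²)`, that is
`(∫ |h|^{1 - q s} ‖K(·, · + h)‖_{L^{p,t}}^q dh)^{1/q}`, with the weight written inside the
power `q` so that `q = ∞` is covered (there `1 / q.toReal = 0`, and the integral is a
supremum). -/
def kernelNorm {m : ℕ} (s p : ℝ) (t q : ℝ≥0∞) (K : ℝ → ℝ → Mat m) : ℝ≥0∞ :=
  eLpNorm (fun h : ℝ => ENNReal.ofReal |h| ^ (1 / q.toReal - s) *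
    lorentzNorm p t (fun x => K x (x + h))) q volume

/-! ### Homogeneous Lorentz-Besov spaces -/

/-- The first-difference norm of the homogeneous Lorentz-Besov space `B^s_{(p,t),q}(ℝ)`,
`0 < s < 1`, that is `(∫ |h|^{-1 - s q} ‖f(· + h) - f‖_{L^{p,t}}^q dh)^{1/q}`. -/
def besovNorm {E : Type*} [NormedAddCommGroup E] (s p : ℝ) (t q : ℝ≥0∞) (f : ℝ → E) : ℝ≥0∞ :=
  eLpNorm (fun h : ℝ => ENNReal.ofReal |h| ^ (-(1 / q.toReal) - s) *
    lorentzNorm p t (fun x => f (x + h) - f x)) q volume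

/-- The norm of the homogeneous Lorentz-Besov space of negative order `B^{-s}_{(p,t),q}(ℝ)`,
`0 < s < 1`, on tempered distributions: the norm dual to that of `B^s_{(p',t'),q'}(ℝ)`. -/
def besovNegNorm {m : ℕ} (s p : ℝ) (t q : ℝ≥0∞) (T : 𝓢(ℝ, Vec m) →L[ℝ] ℝ) : ℝ≥0∞ :=
  ⨆ (φ : 𝓢(ℝ, Vec m))
    (_ : besovNorm s (Real.conjExponent p) (ENNReal.conjExponent t) (ENNReal.conjExponent q)
      (fun x => φ x) ≤ 1), ‖T φ‖ₑ

/-! ### Abstract multi-commutators -/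

/-- The condition `K(x,y) = -Kᵗ(y,x)` for almost every `(x,y)`. -/
def AntiSelfDual {m : ℕ} (K : ℝ → ℝ → Mat m) : Prop :=
  ∀ᵐ z : ℝ × ℝ, K z.1 z.2 = -(K z.2 z.1)ᵀ

/-- The integrand `Kᵗ(x,y) v(x) + K(x,y) v(y)` of the multi-commutator. -/
def multiIntegrand {m : ℕ} (K : ℝ → ℝ → Mat m) (v : ℝ → Vec m) (x y : ℝ) : Vec m :=
  WithLp.toLp 2 ((K x y)ᵀ *ᵥ (v x).ofLp + K x y *ᵥ (v y).ofLp)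

/-- The truncated multi-commutator
`x ↦ ∫_{|x - y| > ε} [Kᵗ(x,y) v(x) + K(x,y) v(y)] dy`. -/
def multiTrunc {m : ℕ} (K : ℝ → ℝ → Mat m) (v : ℝ → Vec m) (ε x : ℝ) : Vec m :=
  ∫ y in {y : ℝ | ε < |x - y|}, multiIntegrand K v x y

/-- The tempered distribution `T` is the multi-commutator
`T_K(v)(x) = ∫ [Kᵗ(x,y) v(x) + K(x,y) v(y)] dy`, the integral being a principal value in the
sense of distributions: all truncated integrals converge absolutely, they define functions that
pair absolutely with test functions, and these functions tend to `T` as the truncation is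
removed. -/
def IsMulticommutator {m : ℕ} (K : ℝ → ℝ → Mat m) (v : ℝ → Vec m)
    (T : 𝓢(ℝ, Vec m) →L[ℝ] ℝ) : Prop :=
  (∀ ε : ℝ, 0 < ε →
    (∀ᵐ x : ℝ, IntegrableOn (fun y => multiIntegrand K v x y) {y : ℝ | ε < |x - y|}) ∧
    ∀ φ : 𝓢(ℝ, Vec m), Integrable (fun x : ℝ => inner ℝ (φ x) (multiTrunc K v ε x))) ∧
  ∀ φ : 𝓢(ℝ, Vec m),
    Tendsto (fun ε : ℝ => ∫ x : ℝ, inner ℝ (φ x) (multiTrunc K v ε x)) (𝓝[>] 0) (𝓝 (T φ))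

end

/-! Test the truncated multi-commutator against a Schwartz function `φ` and exchange `x` and `y` in
the term containing `v(y)`. Anti-self-duality turns the sum of the two terms into the integral of
`⟨φ(x) - φ(y), Kᵗ(x,y) v(x)⟩` over `|x - y| > ε`. The singularity of `K` on the diagonal is thus
compensated by a first difference of `φ`, which is what a Besov norm of positive order measures.

With `y = x + h`, Hölder's inequality in Lorentz spaces bounds the `x`-integral by the product of
the norms of `v` in `L^{r,∞}`, of `K(·,·+h)` in `L^{p,t}` and of the difference of `φ` in
`L^{P,t'}`, where `1/r + 1/p + 1/P = 1`. The choice `s = 2/q - 1 + σ` makes the two weights in `|h|`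
mutually inverse, so Hölder in `h` with exponents `q`, `q'` finishes the estimate with constant 1
(`lintegral_mul_kernel_le`, `lintegral_compensatedPairing_le`). The Lorentz step rests on the
Hardy-Littlewood inequality for three functions (`lintegral_mul_mul_le_rearr`).

Schwartz functions have finite Besov norm, so the compensated integrand is integrable on the whole
plane. Its integral defines the distribution, and dominated convergence identifies it with the limit
of the truncations. The same kernel inequality, with the difference replaced by a weight cut off
near the diagonal, gives absolute convergence of the truncated integrals. -/

/-! ### Decreasing rearrangement of extended nonnegative functions -/

/-- The decreasing rearrangement of a function with values in `[0, ∞]`. -/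
noncomputable def rearr (f : ℝ → ℝ≥0∞) (τ : ℝ) : ℝ≥0∞ :=
  sInf {l : ℝ≥0∞ | volume {x : ℝ | l < f x} ≤ ENNReal.ofReal τ}

/-- The infimum is attained because the distribution function is right continuous: `{a < f}` is the
increasing union of `{u n < f}` as `u n` decreases to `a`. Questions about `rearr` thereby become
questions about superlevel sets. -/
theorem rearr_le_iff (f : ℝ → ℝ≥0∞) (τ : ℝ) (a : ℝ≥0∞) :
    rearr f τ ≤ a ↔ volume {x | a < f x} ≤ ENNReal.ofReal τ := by
  refine ⟨fun h => ?_, fun h => sInf_le h⟩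
  rcases eq_or_ne a ∞ with rfl | ha
  · simp
  obtain ⟨u, hu, hau, hlim⟩ := exists_seq_strictAnti_tendsto' (lt_top_iff_ne_top.2 ha)
  have hunion : {x | a < f x} = ⋃ n, {x | u n < f x} := by
    ext x
    simp only [mem_ofPred_eq, mem_iUnion]
    refine ⟨fun hx => (hlim.eventually_lt_const hx).exists, fun ⟨n, hn⟩ => (hau n).1.trans hn⟩
  have hmono : Monotone fun n => {x | u n < f x} :=
    fun i j hij x hx => (hu.antitone hij).trans_lt hx
  rw [hunion, hmono.measure_iUnion]
  refine iSup_le fun n => ?_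
  obtain ⟨l, hl, hln⟩ := sInf_lt_iff.1 (h.trans_lt (hau n).1)
  exact (measure_mono fun x hx => hln.trans hx).trans hl

theorem lt_rearr_iff (f : ℝ → ℝ≥0∞) (τ : ℝ) (a : ℝ≥0∞) :
    a < rearr f τ ↔ ENNReal.ofReal τ < volume {x | a < f x} := by
  rw [← not_le, rearr_le_iff, not_le]

theorem rearr_congr_ae {f g : ℝ → ℝ≥0∞} (h : f =ᵐ[volume] g) : rearr f = rearr g := by
  funext τ
  refine eq_of_forall_ge_iff fun a => ?_
  have : volume {x | a < f x} = volume {x | a < g x} := by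
    refine measure_congr (h.mono fun x hx => ?_)
    exact congrArg (fun z => a < z) hx
  rw [rearr_le_iff, rearr_le_iff, this]

theorem rearr_comp_add_right (f : ℝ → ℝ≥0∞) (h : ℝ) : rearr (fun x => f (x + h)) = rearr f := by
  funext τ
  refine eq_of_forall_ge_iff fun a => ?_
  rw [rearr_le_iff, rearr_le_iff]
  have := measure_preimage_add_right (volume : Measure ℝ) h {x | a < f x}
  simp only [preimage_ofPred_eq] at this
  rw [this]

theorem measurable_rearr_uncurry {α : Type*} [MeasurableSpace α] {k : α → ℝ → ℝ≥0∞}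
    (hk : Measurable (Function.uncurry k)) :
    Measurable fun z : α × ℝ => rearr (k z.1) z.2 := by
  refine measurable_of_Iic fun a => ?_
  have hset : MeasurableSet {w : α × ℝ | a < k w.1 w.2} := measurableSet_lt measurable_const hk
  have h1 : Measurable fun z : α => volume {x | a < k z x} := measurable_measure_prodMk_left hset
  have : (fun z : α × ℝ => rearr (k z.1) z.2) ⁻¹' Iic a =
      {z | volume {x | a < k z.1 x} ≤ ENNReal.ofReal z.2} := by
    ext z
    simp [rearr_le_iff]
  rw [this]
  exact measurableSet_le (h1.comp measurable_fst) (ENNReal.measurable_ofReal.comp measurable_snd)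

theorem measurable_rearr (f : ℝ → ℝ≥0∞) : Measurable (rearr f) := by
  refine Antitone.measurable fun s t hst => (rearr_le_iff _ _ _).2 ?_
  exact ((rearr_le_iff _ _ _).1 le_rfl).trans (ENNReal.ofReal_le_ofReal hst)

theorem volume_pos_ofReal_lt (c : ℝ≥0∞) : volume {a : ℝ | 0 < a ∧ ENNReal.ofReal a < c} = c := by
  rcases eq_or_ne c ∞ with rfl | hc
  · have : {a : ℝ | 0 < a ∧ ENNReal.ofReal a < ∞} = Ioi 0 := by ext; simp
    rw [this, Real.volume_Ioi]
  · have : {a : ℝ | 0 < a ∧ ENNReal.ofReal a < c} = Ioo 0 c.toReal := by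
      ext a
      simp only [mem_ofPred_eq, mem_Ioo, and_congr_right_iff]
      exact fun ha => ENNReal.ofReal_lt_iff_lt_toReal ha.le hc
    rw [this, Real.volume_Ioo, sub_zero, ENNReal.ofReal_toReal hc]

theorem lintegral_indicator_pos_ofReal_lt (c : ℝ≥0∞) :
    ∫⁻ a : ℝ, {a : ℝ | 0 < a ∧ ENNReal.ofReal a < c}.indicator 1 a = c := by
  rw [lintegral_indicator_one, volume_pos_ofReal_lt]
  exact (measurableSet_lt measurable_const measurable_id).inter
    (measurableSet_lt ENNReal.measurable_ofReal measurable_const)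

/-- One step of the Hardy-Littlewood inequality: a bound of the integrals of `g` over sets by
integrals of `G` over intervals is inherited by `f * g` and `rearr f * G`. -/
theorem setLIntegral_mul_le_rearr_mul {f g G : ℝ → ℝ≥0∞} (hf : Measurable f) (hg : Measurable g)
    (hG : Measurable G)
    (h : ∀ E, MeasurableSet E → ∫⁻ x in E, g x ≤
      ∫⁻ τ in {τ : ℝ | 0 < τ ∧ ENNReal.ofReal τ < volume E}, G τ)
    (E : Set ℝ) (hE : MeasurableSet E) :
    ∫⁻ x in E, f x * g x ≤
      ∫⁻ τ in {τ : ℝ | 0 < τ ∧ ENNReal.ofReal τ < volume E}, rearr f τ * G τ := by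
  have hpos : ∀ c : ℝ≥0∞, MeasurableSet {a : ℝ | 0 < a ∧ ENNReal.ofReal a < c} := fun c =>
    (measurableSet_lt measurable_const measurable_id).inter
      (measurableSet_lt ENNReal.measurable_ofReal measurable_const)
  have hmeas : ∀ {F : ℝ → ℝ≥0∞}, Measurable F → Measurable fun z : ℝ × ℝ =>
      {a : ℝ | 0 < a ∧ ENNReal.ofReal a < F z.1}.indicator (1 : ℝ → ℝ≥0∞) z.2 := by
    intro F hF
    have hs : MeasurableSet {z : ℝ × ℝ | 0 < z.2 ∧ ENNReal.ofReal z.2 < F z.1} :=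
      (measurableSet_lt measurable_const measurable_snd).inter
        (measurableSet_lt (ENNReal.measurable_ofReal.comp measurable_snd) (hF.comp measurable_fst))
    exact (measurable_one.indicator hs : Measurable
      ({z : ℝ × ℝ | 0 < z.2 ∧ ENNReal.ofReal z.2 < F z.1}.indicator (1 : ℝ × ℝ → ℝ≥0∞)))
  have layer : ∀ (F H : ℝ → ℝ≥0∞) (S : Set ℝ), Measurable F → Measurable H → MeasurableSet S →
      ∫⁻ x in S, F x * H x = ∫⁻ a in Ioi (0 : ℝ), ∫⁻ x in S ∩ {x | ENNReal.ofReal a < F x}, H x := by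
    intro F H S hF hH hS
    calc ∫⁻ x in S, F x * H x
        = ∫⁻ x in S, ∫⁻ a, {a : ℝ | 0 < a ∧ ENNReal.ofReal a < F x}.indicator 1 a * H x := by
          refine lintegral_congr fun x => ?_
          rw [lintegral_mul_const _ (measurable_one.indicator (hpos _)),
            lintegral_indicator_pos_ofReal_lt]
      _ = ∫⁻ a, ∫⁻ x in S, {a : ℝ | 0 < a ∧ ENNReal.ofReal a < F x}.indicator 1 a * H x :=
          lintegral_lintegral_swap
            (((hmeas hF).mul (hH.comp measurable_fst)).aemeasurable)
      _ = ∫⁻ a in Ioi (0 : ℝ), ∫⁻ x in S ∩ {x | ENNReal.ofReal a < F x}, H x := by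
          rw [← lintegral_indicator measurableSet_Ioi]
          refine lintegral_congr fun a => ?_
          by_cases ha : 0 < a
          · rw [indicator_of_mem (mem_Ioi.2 ha), inter_comm, ← setLIntegral_indicator
              (measurableSet_lt measurable_const hF)]
            refine lintegral_congr fun x => ?_
            by_cases hx : ENNReal.ofReal a < F x <;> simp [indicator, ha, hx]
          · rw [indicator_of_notMem (by simpa using ha)]
            simp [indicator, ha]
  rw [layer f g E hf hg hE, layer (rearr f) G _ (measurable_rearr f) hG (hpos _)]
  refine lintegral_mono fun a => (h _ (hE.inter (measurableSet_lt measurable_const hf))).trans ?_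
  -- The interval of length `|E ∩ {a < f}|` lies both in the interval of length `|E|` and in `{a <
  -- rearr f}`.
  refine lintegral_mono_set fun τ hτ => ?_
  refine ⟨⟨hτ.1, hτ.2.trans_le (measure_mono inter_subset_left)⟩, ?_⟩
  exact (lt_rearr_iff _ _ _).2 (hτ.2.trans_le (measure_mono inter_subset_right))

/-- Iterates the preceding step, inserting `w`, `k` and `u` one at a time and starting from the
constant 1. The intermediate bounds must hold on every measurable set; only the last is specialised
to the whole line. -/
theorem lintegral_mul_mul_le_rearr {u k w : ℝ → ℝ≥0∞} (hu : Measurable u) (hk : Measurable k)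
    (hw : Measurable w) :
    ∫⁻ x, u x * (k x * w x) ≤ ∫⁻ τ in Ioi (0 : ℝ), rearr u τ * (rearr k τ * rearr w τ) := by
  have h1 : ∀ E : Set ℝ, MeasurableSet E → ∫⁻ _ in E, (1 : ℝ≥0∞) ≤
      ∫⁻ _ in {τ : ℝ | 0 < τ ∧ ENNReal.ofReal τ < volume E}, (1 : ℝ≥0∞) := by
    intro E _
    rw [setLIntegral_one, setLIntegral_one, volume_pos_ofReal_lt]
  have h2 := setLIntegral_mul_le_rearr_mul hw measurable_const measurable_const h1
  simp only [mul_one] at h2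
  have h3 := setLIntegral_mul_le_rearr_mul hk hw (measurable_rearr w) h2
  have h4 := setLIntegral_mul_le_rearr_mul hu (hk.mul hw)
    ((measurable_rearr k).mul (measurable_rearr w)) h3 univ MeasurableSet.univ
  have h5 : {τ : ℝ | 0 < τ ∧ ENNReal.ofReal τ < volume (univ : Set ℝ)} = Ioi 0 := by
    ext; simp
  rw [h5] at h4
  simpa using h4

/-! ### Lorentz norms of extended nonnegative functions -/

/-- Hölder with the endpoint pairs `(1, ∞)` and `(∞, 1)` included, since `t = 1`, `t = ∞` and `q =
∞` are all allowed. -/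
theorem lintegral_mul_le_eLpNorm_mul_eLpNorm {α : Type*} [MeasurableSpace α] {μ : Measure α}
    {p q : ℝ≥0∞} (hpq : p.HolderConjugate q) {f g : α → ℝ≥0∞} (hf : AEMeasurable f μ)
    (hg : AEMeasurable g μ) :
    ∫⁻ x, f x * g x ∂μ ≤ eLpNorm f p μ * eLpNorm g q μ := by
  have key : ∀ {f g : α → ℝ≥0∞}, AEMeasurable f μ →
      ∫⁻ x, f x * g x ∂μ ≤ eLpNorm f 1 μ * eLpNorm g ∞ μ := by
    intro f g hf
    rw [eLpNorm_one_eq_lintegral_enorm, eLpNorm_exponent_top, eLpNormEssSup]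
    simp only [enorm_eq_self]
    rw [← lintegral_mul_const'' _ hf]
    refine lintegral_mono_ae ?_
    filter_upwards [ENNReal.ae_le_essSup (μ := μ) g] with x hx
    gcongr
  have := hpq
  have := hpq.symm
  rcases eq_or_ne p ∞ with rfl | hp
  · obtain rfl : q = 1 := ENNReal.HolderConjugate.unique ∞ q 1
    simpa only [mul_comm] using key (f := g) (g := f) hg
  rcases eq_or_ne q ∞ with rfl | hq
  · obtain rfl : p = 1 := ENNReal.HolderConjugate.unique ∞ p 1
    exact key hf
  have hR : p.toReal.HolderConjugate q.toReal :=
    ENNReal.HolderConjugate.toReal_of_ne_top hp hq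
  rw [eLpNorm_eq_lintegral_rpow_enorm_toReal (by
      intro h; simpa [h] using hR.pos) hp, eLpNorm_eq_lintegral_rpow_enorm_toReal (by
      intro h; simpa [h] using hR.symm.pos) hq]
  simpa using ENNReal.lintegral_mul_le_Lp_mul_Lq μ hR hf hg

/-- The Lorentz (quasi-)norm of a function with values in `[0, ∞]`. -/
noncomputable def lorentz (p : ℝ) (t : ℝ≥0∞) (f : ℝ → ℝ≥0∞) : ℝ≥0∞ :=
  eLpNorm (fun τ : ℝ => ENNReal.ofReal τ ^ (1 / p) * rearr f τ) t haarPos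

theorem lorentzNorm_eq_lorentz {E : Type*} [NormedAddCommGroup E] (p : ℝ) (t : ℝ≥0∞) (f : ℝ → E) :
    lorentzNorm p t f = lorentz p t fun x => ‖f x‖ₑ := rfl

theorem lorentz_congr_ae {p : ℝ} {t : ℝ≥0∞} {f g : ℝ → ℝ≥0∞} (h : f =ᵐ[volume] g) :
    lorentz p t f = lorentz p t g := by
  rw [lorentz, lorentz, rearr_congr_ae h]

theorem lorentz_comp_add_right (p : ℝ) (t : ℝ≥0∞) (f : ℝ → ℝ≥0∞) (h : ℝ) :
    lorentz p t (fun x => f (x + h)) = lorentz p t f := by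
  rw [lorentz, lorentz, rearr_comp_add_right]

instance : SFinite haarPos := by
  unfold haarPos
  infer_instance

theorem lintegral_haarPos {F : ℝ → ℝ≥0∞} (hF : Measurable F) :
    ∫⁻ τ, F τ ∂haarPos = ∫⁻ τ in Ioi (0 : ℝ), ENNReal.ofReal τ⁻¹ * F τ := by
  rw [haarPos, lintegral_withDensity_eq_lintegral_mul _ (by fun_prop) hF]
  rfl

/-- After passing to rearrangements, the weak norm of `u` comes out as an essential supremum and
Hölder for `dτ/τ` treats the other two factors. No constant is lost. -/
theorem lintegral_mul_mul_le_lorentz {r p P : ℝ} (h1 : 1 / r + 1 / p + 1 / P = 1) {t t' : ℝ≥0∞}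
    (ht : t.HolderConjugate t') {u k w : ℝ → ℝ≥0∞} (hu : Measurable u) (hk : Measurable k)
    (hw : Measurable w) :
    ∫⁻ x, u x * (k x * w x) ≤ lorentz r ∞ u * (lorentz p t k * lorentz P t' w) := by
  have hm : ∀ (c : ℝ) (f : ℝ → ℝ≥0∞),
      Measurable fun τ : ℝ => ENNReal.ofReal τ ^ (1 / c) * rearr f τ := fun c f =>
    (ENNReal.measurable_ofReal.pow_const _).mul (measurable_rearr f)
  calc ∫⁻ x, u x * (k x * w x)
      ≤ ∫⁻ τ in Ioi (0 : ℝ), rearr u τ * (rearr k τ * rearr w τ) :=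
        lintegral_mul_mul_le_rearr hu hk hw
    _ = ∫⁻ τ, (ENNReal.ofReal τ ^ (1 / r) * rearr u τ) *
          ((ENNReal.ofReal τ ^ (1 / p) * rearr k τ) * (ENNReal.ofReal τ ^ (1 / P) * rearr w τ))
          ∂haarPos := by
        rw [lintegral_haarPos (by have := hm r u; have := hm p k; have := hm P w; fun_prop)]
        refine setLIntegral_congr_fun measurableSet_Ioi fun τ hτ => ?_
        have hτ0 : ENNReal.ofReal τ ≠ 0 := by simpa using hτ
        -- The three powers of `τ` multiply to `τ`, which absorbs the density of `dτ/τ`.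
        have : ENNReal.ofReal τ⁻¹ * (ENNReal.ofReal τ ^ (1 / r) * ENNReal.ofReal τ ^ (1 / p) *
            ENNReal.ofReal τ ^ (1 / P)) = 1 := by
          rw [← ENNReal.rpow_add _ _ hτ0 ENNReal.ofReal_ne_top,
            ← ENNReal.rpow_add _ _ hτ0 ENNReal.ofReal_ne_top, h1, ENNReal.rpow_one,
            ENNReal.ofReal_inv_of_pos hτ, ENNReal.inv_mul_cancel hτ0 ENNReal.ofReal_ne_top]
        calc rearr u τ * (rearr k τ * rearr w τ)
            = (ENNReal.ofReal τ⁻¹ * (ENNReal.ofReal τ ^ (1 / r) * ENNReal.ofReal τ ^ (1 / p) *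
              ENNReal.ofReal τ ^ (1 / P))) * (rearr u τ * (rearr k τ * rearr w τ)) := by
              rw [this, one_mul]
          _ = _ := by ring
    _ ≤ ∫⁻ τ, lorentz r ∞ u *
          ((ENNReal.ofReal τ ^ (1 / p) * rearr k τ) * (ENNReal.ofReal τ ^ (1 / P) * rearr w τ))
          ∂haarPos := by
        refine lintegral_mono_ae ?_
        filter_upwards [ENNReal.ae_le_essSup (μ := haarPos)
          fun τ : ℝ => ENNReal.ofReal τ ^ (1 / r) * rearr u τ] with τ hτ
        have : lorentz r ∞ u =
            essSup (fun τ : ℝ => ENNReal.ofReal τ ^ (1 / r) * rearr u τ) haarPos := by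
          rw [lorentz, eLpNorm_exponent_top, eLpNormEssSup]
          simp only [enorm_eq_self]
        rw [this]
        gcongr
    _ ≤ _ := by
        rw [lintegral_const_mul _ (by have := hm p k; have := hm P w; fun_prop)]
        gcongr
        exact lintegral_mul_le_eLpNorm_mul_eLpNorm ht (hm _ _).aemeasurable (hm _ _).aemeasurable

/-- Makes the Lorentz norm of a slice measurable in the shift `h`. For exponent `∞`, a sublevel set
of the essential supremum is described by the vanishing of the measure of a section. -/
theorem measurable_eLpNorm_right {α β : Type*} [MeasurableSpace α] [MeasurableSpace β]
    {μ : Measure β} [SFinite μ] {F : α → β → ℝ≥0∞} (hF : Measurable (Function.uncurry F))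
    (t : ℝ≥0∞) : Measurable fun a => eLpNorm (F a) t μ := by
  rcases eq_or_ne t 0 with rfl | h0
  · simp
  rcases eq_or_ne t ∞ with rfl | ht
  · refine measurable_of_Iic fun c => ?_
    have hset : MeasurableSet {z : α × β | c < F z.1 z.2} := measurableSet_lt measurable_const hF
    have : (fun a => eLpNorm (F a) ∞ μ) ⁻¹' Iic c = {a | μ {b | c < F a b} = 0} := by
      ext a
      rw [mem_preimage, mem_Iic, eLpNorm_exponent_top, eLpNormEssSup, mem_ofPred_eq]
      simp only [enorm_eq_self]
      constructor
      · intro h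
        have h2 := ENNReal.ae_le_essSup (μ := μ) (F a)
        refine measure_mono_null (fun b hb => ?_) (ae_iff.1 h2)
        exact not_le.2 (h.trans_lt hb)
      · intro h
        refine essSup_le_of_ae_le _ (ae_iff.2 ?_)
        simpa using h
    rw [this]
    exact measurable_measure_prodMk_left hset (measurableSet_singleton 0)
  · simp only [eLpNorm_eq_lintegral_rpow_enorm_toReal h0 ht, enorm_eq_self]
    have h1 : Measurable fun z : α × β => F z.1 z.2 ^ t.toReal := Measurable.pow_const hF _
    exact (Measurable.lintegral_prod_right' (f := fun z : α × β => F z.1 z.2 ^ t.toReal) h1).pow_const _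

theorem measurable_lorentz {α : Type*} [MeasurableSpace α] {k : α → ℝ → ℝ≥0∞}
    (hk : Measurable (Function.uncurry k)) (p : ℝ) (t : ℝ≥0∞) :
    Measurable fun a => lorentz p t (k a) :=
  measurable_eLpNorm_right (F := fun a τ => ENNReal.ofReal τ ^ (1 / p) * rearr (k a) τ)
    (((ENNReal.measurable_ofReal.comp measurable_snd).pow_const _).mul
      (measurable_rearr_uncurry hk)) t

/-! ### Finiteness of Lorentz and Lorentz-Besov norms of test functions -/

/-- The integrand is at most `τ^(aT-1)` near 0 and `τ^((a-1)T-1)` near infinity. Used with `a = 1/p`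
for Lorentz norms and with `a = 1 - s` for Besov weights. -/
theorem setLIntegral_inv_mul_cutoff_lt_top {a T : ℝ} (ha0 : 0 < a) (ha1 : a < 1) (hT : 0 < T) :
    ∫⁻ τ in Ioi (0 : ℝ), ENNReal.ofReal τ⁻¹ *
      (ENNReal.ofReal τ ^ a * min 1 (ENNReal.ofReal τ)⁻¹) ^ T < ∞ := by
  rw [← Ioc_union_Ioi_eq_Ioi (zero_le_one' ℝ)]
  refine (lintegral_union_le _ _ _).trans_lt (ENNReal.add_lt_top.2 ⟨?_, ?_⟩)
  · have hint : IntegrableOn (fun τ : ℝ => τ ^ (a * T - 1)) (Ioc 0 1) := by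
      rw [← intervalIntegrable_iff_integrableOn_Ioc_of_le zero_le_one]
      exact intervalIntegral.intervalIntegrable_rpow' (by nlinarith [mul_pos ha0 hT])
    refine lt_of_le_of_lt (setLIntegral_mono' measurableSet_Ioc fun τ hτ => ?_)
      hint.lintegral_lt_top
    have hτ0 : ENNReal.ofReal τ ≠ 0 := by simpa using hτ.1
    calc ENNReal.ofReal τ⁻¹ * (ENNReal.ofReal τ ^ a * min 1 (ENNReal.ofReal τ)⁻¹) ^ T
        ≤ ENNReal.ofReal τ⁻¹ * (ENNReal.ofReal τ ^ a * 1) ^ T := by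
          gcongr; exact min_le_left _ _
      _ = ENNReal.ofReal (τ ^ (a * T - 1)) := by
          rw [mul_one, ENNReal.ofReal_inv_of_pos hτ.1, ← ENNReal.rpow_mul, ← ENNReal.rpow_neg_one,
            ← ENNReal.rpow_add _ _ hτ0 ENNReal.ofReal_ne_top, ENNReal.ofReal_rpow_of_pos hτ.1]
          congr 2; ring
  · have hint : IntegrableOn (fun τ : ℝ => τ ^ ((a - 1) * T - 1)) (Ioi 1) :=
      integrableOn_Ioi_rpow_of_lt (by nlinarith [mul_pos (sub_pos.2 ha1) hT]) zero_lt_one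
    refine lt_of_le_of_lt (setLIntegral_mono' measurableSet_Ioi fun τ hτ => ?_)
      hint.lintegral_lt_top
    have hτ' : 0 < τ := zero_lt_one.trans hτ
    have hτ0 : ENNReal.ofReal τ ≠ 0 := by simpa using hτ'
    calc ENNReal.ofReal τ⁻¹ * (ENNReal.ofReal τ ^ a * min 1 (ENNReal.ofReal τ)⁻¹) ^ T
        ≤ ENNReal.ofReal τ⁻¹ * (ENNReal.ofReal τ ^ a * (ENNReal.ofReal τ)⁻¹) ^ T := by
          gcongr; exact min_le_right _ _
      _ = ENNReal.ofReal (τ ^ ((a - 1) * T - 1)) := by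
          rw [ENNReal.ofReal_inv_of_pos hτ', ← ENNReal.rpow_neg_one,
            ← ENNReal.rpow_add _ _ hτ0 ENNReal.ofReal_ne_top, ← ENNReal.rpow_mul,
            ← ENNReal.rpow_add _ _ hτ0 ENNReal.ofReal_ne_top, ENNReal.ofReal_rpow_of_pos hτ']
          congr 2; ring

/-- The Lorentz norm of the function whose rearrangement is `min 1 τ⁻¹`. -/
noncomputable def cutoffConst (p : ℝ) (t : ℝ≥0∞) : ℝ≥0∞ :=
  eLpNorm (fun τ : ℝ => ENNReal.ofReal τ ^ (1 / p) * min 1 (ENNReal.ofReal τ)⁻¹) t haarPos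

theorem cutoffConst_lt_top {p : ℝ} (hp : 1 < p) {t : ℝ≥0∞} (ht : 1 ≤ t) :
    cutoffConst p t < ∞ := by
  have hp0 : 0 < 1 / p := by positivity
  have hp1 : 1 / p < 1 := by rw [div_lt_one (by positivity)]; exact hp
  unfold cutoffConst
  rcases eq_or_ne t ∞ with rfl | htop
  · refine (eLpNormEssSup_le_of_ae_enorm_bound (C := 1) (Eventually.of_forall fun τ => ?_)).trans_lt
      ENNReal.one_lt_top
    rw [enorm_eq_self]
    set x := ENNReal.ofReal τ
    rcases le_total x 1 with hx | hx
    · calc x ^ (1 / p) * min 1 x⁻¹ ≤ 1 * 1 := by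
            gcongr
            · exact ENNReal.rpow_le_one hx hp0.le
            · exact min_le_left _ _
        _ = 1 := one_mul 1
    · calc x ^ (1 / p) * min 1 x⁻¹ ≤ x ^ (1 : ℝ) * x⁻¹ := by
            gcongr
            exact min_le_right _ _
        _ ≤ 1 := by rw [ENNReal.rpow_one]; exact ENNReal.mul_inv_le_one x
  · have ht0 : t ≠ 0 := (zero_lt_one.trans_le ht).ne'
    rw [eLpNorm_eq_lintegral_rpow_enorm_toReal ht0 htop]
    refine ENNReal.rpow_lt_top_of_nonneg (by positivity) (ne_of_lt ?_)
    simp only [enorm_eq_self]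
    rw [lintegral_haarPos (by fun_prop)]
    exact setLIntegral_inv_mul_cutoff_lt_top hp0 hp1 (ENNReal.toReal_pos ht0 htop)

/-- The sup bound gives the constant branch of the minimum, Chebyshev's inequality the branch `1/τ`.
-/
theorem rearr_le_of_le_of_lintegral_le {w : ℝ → ℝ≥0∞} (hw : Measurable w) {M : ℝ≥0∞}
    (hM : M ≠ ∞) (h1 : ∀ x, w x ≤ M) (h2 : ∫⁻ x, w x ≤ M) {τ : ℝ} (hτ : 0 < τ) :
    rearr w τ ≤ M * min 1 (ENNReal.ofReal τ)⁻¹ := by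
  have hM0 : rearr w τ ≤ M := by
    rw [rearr_le_iff]
    have : {x | M < w x} = ∅ := eq_empty_of_forall_notMem fun x hx => (h1 x).not_gt hx
    simp [this]
  rcases eq_or_ne M 0 with rfl | hMne
  · simpa using hM0
  rcases min_choice 1 (ENNReal.ofReal τ)⁻¹ with h | h <;> rw [h]
  · simpa using hM0
  have hτ0 : ENNReal.ofReal τ ≠ 0 := by simpa using hτ
  rw [rearr_le_iff]
  set l := M * (ENNReal.ofReal τ)⁻¹ with hl
  have hl0 : l ≠ 0 := mul_ne_zero hMne (ENNReal.inv_ne_zero.2 ENNReal.ofReal_ne_top)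
  have hltop : l ≠ ∞ := ENNReal.mul_ne_top hM (ENNReal.inv_ne_top.2 hτ0)
  have h3 : l * volume {x | l ≤ w x} ≤ l * ENNReal.ofReal τ := by
    refine (mul_meas_ge_le_lintegral₀ hw.aemeasurable l).trans (h2.trans_eq ?_)
    rw [hl, mul_assoc, ENNReal.inv_mul_cancel hτ0 ENNReal.ofReal_ne_top, mul_one]
  exact (measure_mono fun x hx => (le_of_lt hx : l ≤ w x)).trans
    ((ENNReal.mul_le_mul_iff_right hl0 hltop).1 h3)

theorem ae_haarPos_pos : ∀ᵐ τ ∂haarPos, 0 < τ :=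
  (withDensity_absolutelyContinuous _ _).ae_le (ae_restrict_mem measurableSet_Ioi)

theorem eLpNorm_le_const_mul_eLpNorm {α : Type*} [MeasurableSpace α] {μ : Measure α}
    {f g : α → ℝ≥0∞} {c : ℝ≥0∞} (hc : c ≠ ∞) (h : ∀ᵐ x ∂μ, f x ≤ c * g x) (p : ℝ≥0∞) :
    eLpNorm f p μ ≤ c * eLpNorm g p μ := by
  lift c to ℝ≥0 using hc
  exact eLpNorm_le_nnreal_smul_eLpNorm_of_ae_le_mul' (by simpa using h) p

theorem lorentz_le_of_le_of_lintegral_le {w : ℝ → ℝ≥0∞} (hw : Measurable w) {M : ℝ}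
    (h1 : ∀ x, w x ≤ ENNReal.ofReal M) (h2 : ∫⁻ x, w x ≤ ENNReal.ofReal M) (p : ℝ) (t : ℝ≥0∞) :
    lorentz p t w ≤ ENNReal.ofReal M * cutoffConst p t := by
  refine eLpNorm_le_const_mul_eLpNorm ENNReal.ofReal_ne_top ?_ t
  filter_upwards [ae_haarPos_pos] with τ hτ
  calc ENNReal.ofReal τ ^ (1 / p) * rearr w τ
      ≤ ENNReal.ofReal τ ^ (1 / p) * (ENNReal.ofReal M * min 1 (ENNReal.ofReal τ)⁻¹) := by
        gcongr
        exact rearr_le_of_le_of_lintegral_le hw ENNReal.ofReal_ne_top h1 h2 hτ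
    _ = _ := by ring

theorem lintegral_inv_one_add_sq (A : ℝ) (hA : 0 ≤ A) :
    ∫⁻ x : ℝ, ENNReal.ofReal (A * (1 + x ^ 2)⁻¹) = ENNReal.ofReal (A * Real.pi) := by
  rw [← ofReal_integral_eq_lintegral_ofReal (integrable_inv_one_add_sq.const_mul A)
    (Eventually.of_forall fun x => by positivity), integral_const_mul, integral_univ_inv_one_add_sq]

theorem lorentz_le_of_le_inv_one_add_sq {w : ℝ → ℝ≥0∞} (hw : Measurable w) {A : ℝ} (hA : 0 ≤ A)
    (h : ∀ x, w x ≤ ENNReal.ofReal (A * (1 + x ^ 2)⁻¹)) (p : ℝ) (t : ℝ≥0∞) :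
    lorentz p t w ≤ ENNReal.ofReal (4 * A) * cutoffConst p t := by
  refine lorentz_le_of_le_of_lintegral_le hw (fun x => (h x).trans ?_)
    ((lintegral_mono h).trans ?_) p t
  · refine ENNReal.ofReal_le_ofReal ?_
    have : (1 + x ^ 2)⁻¹ ≤ 1 := inv_le_one_of_one_le₀ (by nlinarith [sq_nonneg x])
    nlinarith
  · rw [lintegral_inv_one_add_sq A hA]
    exact ENNReal.ofReal_le_ofReal (by nlinarith [Real.pi_le_four])

/-- The Schwartz seminorm that controls the decay of a function and of its derivative. -/
noncomputable def decaySeminorm (V : Type*) [NormedAddCommGroup V] [NormedSpace ℝ V] :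
    Seminorm ℝ 𝓢(ℝ, V) :=
  (Finset.Iic (2, 1)).sup (schwartzSeminormFamily ℝ ℝ V)

section Schwartz

variable {V : Type*} [NormedAddCommGroup V] [NormedSpace ℝ V]

theorem le_mul_inv_one_add_sq {x c S : ℝ} (hc : 0 ≤ c) (h : (1 + ‖x‖) ^ 2 * c ≤ S) :
    c ≤ S * (1 + x ^ 2)⁻¹ := by
  rw [← div_eq_mul_inv, le_div_iff₀ (by positivity), mul_comm]
  refine le_trans ?_ h
  gcongr
  have := sq_abs x
  rw [Real.norm_eq_abs]
  nlinarith [abs_nonneg x]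

theorem SchwartzMap.norm_le_decaySeminorm (φ : 𝓢(ℝ, V)) (x : ℝ) :
    ‖φ x‖ ≤ 4 * decaySeminorm V φ * (1 + x ^ 2)⁻¹ := by
  refine le_mul_inv_one_add_sq (norm_nonneg _) ?_
  have := SchwartzMap.one_add_le_sup_seminorm_apply (𝕜 := ℝ) (m := (2, 1)) (k := 2) (n := 0)
    le_rfl (by norm_num) φ x
  rw [norm_iteratedFDeriv_zero] at this
  refine this.trans (le_of_eq ?_)
  rw [decaySeminorm]
  norm_num
  rfl

theorem SchwartzMap.norm_deriv_le_decaySeminorm (φ : 𝓢(ℝ, V)) (x : ℝ) :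
    ‖deriv φ x‖ ≤ 4 * decaySeminorm V φ * (1 + x ^ 2)⁻¹ := by
  refine le_mul_inv_one_add_sq (norm_nonneg _) ?_
  have := SchwartzMap.one_add_le_sup_seminorm_apply (𝕜 := ℝ) (m := (2, 1)) (k := 2) (n := 1)
    le_rfl le_rfl φ x
  rw [norm_iteratedFDeriv_eq_norm_iteratedDeriv, iteratedDeriv_one] at this
  refine this.trans (le_of_eq ?_)
  rw [decaySeminorm]
  norm_num
  rfl

theorem SchwartzMap.norm_sub_le_decaySeminorm (φ : 𝓢(ℝ, V)) (x : ℝ) {h : ℝ} (hh : |h| ≤ 1) :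
    ‖φ (x + h) - φ x‖ ≤ 16 * decaySeminorm V φ * |h| * (1 + x ^ 2)⁻¹ := by
  have hS : 0 ≤ decaySeminorm V φ := apply_nonneg _ _
  have hb : ∀ y ∈ Metric.closedBall x 1,
      ‖deriv φ y‖ ≤ 16 * decaySeminorm V φ * (1 + x ^ 2)⁻¹ := by
    intro y hy
    refine (φ.norm_deriv_le_decaySeminorm y).trans ?_
    rw [Metric.mem_closedBall, Real.dist_eq] at hy
    -- The weight changes by a factor at most 4 over distance 1, hence the constant `16 = 4 · 4` in
    -- the mean value estimate.
    have hle : (1 + y ^ 2)⁻¹ ≤ 4 * (1 + x ^ 2)⁻¹ := by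
      rw [← div_eq_mul_inv, le_div_iff₀ (by positivity), inv_mul_le_iff₀ (by positivity)]
      nlinarith [abs_le.1 hy, sq_nonneg (y - x), sq_nonneg (y + (y - x)), (abs_le_one_iff_mul_self_le_one).1 hy]
    nlinarith [mul_le_mul_of_nonneg_left hle hS]
  have := Convex.norm_image_sub_le_of_norm_deriv_le (f := φ) (x := x) (y := x + h)
    (fun y _ => φ.differentiableAt) hb (convex_closedBall x 1)
    (Metric.mem_closedBall_self zero_le_one) (by simpa [Metric.mem_closedBall, Real.dist_eq] using hh)
  rw [add_sub_cancel_left, Real.norm_eq_abs] at this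
  linarith

theorem measurable_enorm_diff (φ : 𝓢(ℝ, V)) :
    Measurable (Function.uncurry fun h x : ℝ => ‖φ (x + h) - φ x‖ₑ) := by
  have h1 : Continuous fun z : ℝ × ℝ => φ (z.2 + z.1) - φ z.2 :=
    (φ.continuous.comp (continuous_snd.add continuous_fst)).sub (φ.continuous.comp continuous_snd)
  exact h1.enorm.measurable

theorem lorentz_schwartz_le (φ : 𝓢(ℝ, V)) (p : ℝ) (t : ℝ≥0∞) :
    lorentz p t (fun x => ‖φ x‖ₑ) ≤
      ENNReal.ofReal (16 * decaySeminorm V φ) * cutoffConst p t := by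
  have := lorentz_le_of_le_inv_one_add_sq (w := fun x => ‖φ x‖ₑ) φ.continuous.enorm.measurable
    (A := 4 * decaySeminorm V φ) (by positivity)
    (fun x => by
      rw [← ofReal_norm]
      exact ENNReal.ofReal_le_ofReal (φ.norm_le_decaySeminorm x)) p t
  convert this using 3
  ring

/-- Small shifts use the mean value inequality and gain `|h|`; large shifts use the triangle
inequality and translation invariance. -/
theorem lorentz_schwartz_diff_le (φ : 𝓢(ℝ, V)) (p : ℝ) (t : ℝ≥0∞) (h : ℝ) :
    lorentz p t (fun x => ‖φ (x + h) - φ x‖ₑ) ≤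
      ENNReal.ofReal (64 * decaySeminorm V φ) * min 1 (ENNReal.ofReal |h|) * cutoffConst p t := by
  have hS : 0 ≤ decaySeminorm V φ := apply_nonneg _ _
  have hmeas : Measurable fun x => ‖φ (x + h) - φ x‖ₑ :=
    (measurable_enorm_diff φ).comp (measurable_const.prodMk measurable_id)
  rcases le_total |h| 1 with hh | hh
  · have := lorentz_le_of_le_inv_one_add_sq hmeas (A := 16 * decaySeminorm V φ * |h|)
      (by positivity) (fun x => by
        rw [← ofReal_norm]
        exact ENNReal.ofReal_le_ofReal (φ.norm_sub_le_decaySeminorm x hh)) p t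
    refine this.trans (le_of_eq ?_)
    rw [min_eq_right (by simpa using hh), ← ENNReal.ofReal_mul (by positivity)]
    congr 2
    ring
  · rw [min_eq_left (by simpa using hh), mul_one]
    have hpt : ∀ x, ‖φ (x + h) - φ x‖ₑ ≤
        ENNReal.ofReal (4 * decaySeminorm V φ * (1 + (x + h) ^ 2)⁻¹) +
          ENNReal.ofReal (4 * decaySeminorm V φ * (1 + x ^ 2)⁻¹) := by
      intro x
      rw [← ENNReal.ofReal_add (by positivity) (by positivity), ← ofReal_norm]
      refine ENNReal.ofReal_le_ofReal ((norm_sub_le _ _).trans ?_)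
      exact add_le_add (φ.norm_le_decaySeminorm _) (φ.norm_le_decaySeminorm _)
    refine lorentz_le_of_le_of_lintegral_le hmeas (fun x => (hpt x).trans ?_)
      ((lintegral_mono hpt).trans ?_) p t
    · rw [← ENNReal.ofReal_add (by positivity) (by positivity)]
      refine ENNReal.ofReal_le_ofReal ?_
      have h1 : (1 + (x + h) ^ 2)⁻¹ ≤ 1 := inv_le_one_of_one_le₀ (by nlinarith [sq_nonneg (x + h)])
      have h2 : (1 + x ^ 2)⁻¹ ≤ 1 := inv_le_one_of_one_le₀ (by nlinarith [sq_nonneg x])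
      nlinarith
    · rw [lintegral_add_left (by fun_prop), lintegral_add_right_eq_self
        (fun x => ENNReal.ofReal (4 * decaySeminorm V φ * (1 + x ^ 2)⁻¹)) h,
        lintegral_inv_one_add_sq _ (by positivity), ← ENNReal.ofReal_add (by positivity)
        (by positivity)]
      exact ENNReal.ofReal_le_ofReal (by nlinarith [Real.pi_le_four])

end Schwartz

theorem lintegral_comp_abs_eq (g : ℝ → ℝ≥0∞) :
    ∫⁻ h : ℝ, g |h| = 2 * ∫⁻ h in Ioi (0 : ℝ), g h := by
  rw [← lintegral_add_compl (fun h => g |h|) (measurableSet_Ioi (a := (0 : ℝ))), two_mul, compl_Ioi]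
  congr 1
  · exact setLIntegral_congr_fun measurableSet_Ioi fun h hh => by rw [abs_of_pos hh]
  · rw [← restrict_Iio_eq_restrict_Iic]
    have := (Measure.measurePreserving_neg (volume : Measure ℝ)).setLIntegral_comp_preimage_emb
      (MeasurableEquiv.neg ℝ).measurableEmbedding g (Ioi 0)
    rw [← this, neg_preimage, neg_Ioi, neg_zero]
    exact setLIntegral_congr_fun measurableSet_Iio fun h hh => by rw [abs_of_neg hh]

/-- The weight of the first-difference norm, multiplied by `min 1 |h|`. -/
noncomputable def diffConst (s : ℝ) (q : ℝ≥0∞) : ℝ≥0∞ :=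
  eLpNorm (fun h : ℝ => ENNReal.ofReal |h| ^ (-(1 / q.toReal) - s) * min 1 (ENNReal.ofReal |h|)) q
    volume

theorem diffConst_lt_top {s : ℝ} (hs0 : 0 < s) (hs1 : s < 1) {q : ℝ≥0∞} (hq1 : 1 ≤ q)
    (hq : q ≠ ∞) : diffConst s q < ∞ := by
  have hq0 : q ≠ 0 := (zero_lt_one.trans_le hq1).ne'
  have hQ : 0 < q.toReal := ENNReal.toReal_pos hq0 hq
  rw [diffConst, eLpNorm_eq_lintegral_rpow_enorm_toReal hq0 hq]
  refine ENNReal.rpow_lt_top_of_nonneg (by positivity) (ne_of_lt ?_)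
  simp only [enorm_eq_self]
  rw [lintegral_comp_abs_eq fun h => (ENNReal.ofReal h ^ (-(1 / q.toReal) - s) *
    min 1 (ENNReal.ofReal h)) ^ q.toReal]
  refine ENNReal.mul_lt_top (by simp) (lt_of_eq_of_lt ?_
    (setLIntegral_inv_mul_cutoff_lt_top (a := 1 - s) (sub_pos.2 hs1) (by linarith) hQ))
  refine setLIntegral_congr_fun measurableSet_Ioi fun h hh => ?_
  have hh' : (0 : ℝ) < h := hh
  have h0 : ENNReal.ofReal h ≠ 0 := by simpa using hh'
  have ht : ENNReal.ofReal h ≠ ∞ := ENNReal.ofReal_ne_top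
  -- Pulling out one factor `h` brings the integrand to the cutoff form with exponent `1 - s`.
  have hmin : min 1 (ENNReal.ofReal h) = ENNReal.ofReal h * min 1 (ENNReal.ofReal h)⁻¹ := by
    rw [mul_min, mul_one, ENNReal.mul_inv_cancel h0 ht, min_comm]
  have hrest : ENNReal.ofReal h⁻¹ = (ENNReal.ofReal h ^ (-(1 / q.toReal))) ^ q.toReal := by
    rw [← ENNReal.rpow_mul, ENNReal.ofReal_inv_of_pos hh', ← ENNReal.rpow_neg_one]
    congr 1
    field_simp
  rw [hrest, ← ENNReal.mul_rpow_of_nonneg _ _ hQ.le, hmin, ← mul_assoc, ← mul_assoc,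
    ← ENNReal.rpow_add _ _ h0 ht]
  congr 2
  nth_rewrite 2 [← ENNReal.rpow_one (ENNReal.ofReal h)]
  rw [← ENNReal.rpow_add _ _ h0 ht]
  congr 1
  ring

theorem besovNorm_schwartz_le {V : Type*} [NormedAddCommGroup V] [NormedSpace ℝ V] (s p : ℝ)
    (t q : ℝ≥0∞) (hc : cutoffConst p t ≠ ∞) (φ : 𝓢(ℝ, V)) :
    besovNorm s p t q (fun x => φ x) ≤
      ENNReal.ofReal (64 * decaySeminorm V φ) * cutoffConst p t * diffConst s q := by
  refine eLpNorm_le_const_mul_eLpNorm (ENNReal.mul_ne_top ENNReal.ofReal_ne_top hc)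
    (Eventually.of_forall fun h => ?_) q
  rw [lorentzNorm_eq_lorentz]
  calc _ ≤ ENNReal.ofReal |h| ^ (-(1 / q.toReal) - s) *
        (ENNReal.ofReal (64 * decaySeminorm V φ) * min 1 (ENNReal.ofReal |h|) *
          cutoffConst p t) := by
        gcongr
        exact lorentz_schwartz_diff_le φ p t h
    _ = _ := by ring

/-! ### The integral inequality for kernels -/

/-- The relations between the exponents in the duality estimate. -/
structure CompensationExponents (r p P σ s : ℝ) (t t' q q' : ℝ≥0∞) : Prop where
  sum_inv : 1 / r + 1 / p + 1 / P = 1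
  one_lt : 1 < P
  conj_t : t.HolderConjugate t'
  conj_q : q.HolderConjugate q'
  weight : -(1 / q'.toReal) - s = -(1 / q.toReal - -σ)
  s_pos : 0 < s
  s_lt_one : s < 1
  one_le_t' : 1 ≤ t'
  one_le_q' : 1 ≤ q'
  q'_ne_top : q' ≠ ∞

/-- The shear `(h, x) ↦ (x, x + h)` passes from kernels on the plane to their slices at offset `h`.
-/
theorem measurePreserving_prod_add_left :
    MeasurePreserving (fun z : ℝ × ℝ => (z.2, z.2 + z.1)) (volume.prod volume)
      (volume.prod volume) :=
  (measurePreserving_prod_add volume volume).comp Measure.measurePreserving_swap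

theorem ae_ae_shift_of_ae_prod {P : ℝ × ℝ → Prop} (h : ∀ᵐ z, P z) :
    ∀ᵐ h : ℝ, ∀ᵐ x : ℝ, P (x, x + h) :=
  Measure.ae_ae_of_ae_prod (measurePreserving_prod_add_left.quasiMeasurePreserving.ae h)

theorem lintegral_prod_eq_lintegral_shift {F : ℝ × ℝ → ℝ≥0∞} (hF : Measurable F) :
    ∫⁻ z, F z = ∫⁻ h : ℝ, ∫⁻ x : ℝ, F (x, x + h) := by
  rw [Measure.volume_eq_prod, ← measurePreserving_prod_add_left.lintegral_comp hF,
    lintegral_prod (fun z : ℝ × ℝ => F (z.2, z.2 + z.1))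
      (hF.comp measurePreserving_prod_add_left.measurable).aemeasurable]

section

variable {r p P σ s : ℝ} {t t' q q' : ℝ≥0∞}

/-- The core estimate: Lorentz-Hölder on each slice, then Hölder in `h`. `U` is `‖v(x)‖` or
`‖v(y)‖`, whose slices are translates of `‖v‖`, so one `N` serves for all `h`. `W` is either the
difference of `φ` or a weight truncated near the diagonal. -/
theorem lintegral_mul_kernel_le (hE : CompensationExponents r p P σ s t t' q q')
    {U κ W : ℝ × ℝ → ℝ≥0∞} (hU : AEMeasurable U) (hκ : AEMeasurable κ) (hW : Measurable W)
    {N : ℝ≥0∞} (hN : ∀ h, lorentz r ∞ (fun x => U (x, x + h)) ≤ N) :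
    ∫⁻ z, U z * (κ z * W z) ≤ N *
      (eLpNorm (fun h : ℝ => ENNReal.ofReal |h| ^ (1 / q.toReal - -σ) *
          lorentz p t fun x => κ (x, x + h)) q volume *
        eLpNorm (fun h : ℝ => ENNReal.ofReal |h| ^ (-(1 / q'.toReal) - s) *
          lorentz P t' fun x => W (x, x + h)) q' volume) := by
  have hshift : Measurable fun z : ℝ × ℝ => (z.2, z.2 + z.1) :=
    measurePreserving_prod_add_left.measurable
  have hsec : ∀ {F : ℝ × ℝ → ℝ≥0∞}, Measurable F → ∀ h, Measurable fun x => F (x, x + h) :=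
    fun hF h => hF.comp (measurable_id.prodMk (measurable_id.add_const h))
  have hL : ∀ (F : ℝ × ℝ → ℝ≥0∞) (_ : Measurable F) (P' : ℝ) (T : ℝ≥0∞),
      Measurable fun h => lorentz P' T fun x => F (x, x + h) := fun F hF P' T =>
    measurable_lorentz (k := fun h x => F (x, x + h)) (hF.comp hshift) P' T
  have hweight : ∀ c : ℝ, Measurable fun h : ℝ => ENNReal.ofReal |h| ^ c := fun c =>
    (ENNReal.measurable_ofReal.comp measurable_norm).pow_const c
  -- Measurable representatives agree with the originals only almost everywhere in the plane, hence
  -- on almost every slice, up to a null set there.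
  have hκ_ae : ∀ᵐ h : ℝ, lorentz p t (fun x => hκ.mk κ (x, x + h)) =
      lorentz p t (fun x => κ (x, x + h)) :=
    (ae_ae_shift_of_ae_prod hκ.ae_eq_mk).mono fun h hh =>
      lorentz_congr_ae (hh.mono fun x hx => hx.symm)
  have hU_ae : ∀ᵐ h : ℝ, lorentz r ∞ (fun x => hU.mk U (x, x + h)) ≤ N :=
    (ae_ae_shift_of_ae_prod hU.ae_eq_mk).mono fun h hh =>
      (lorentz_congr_ae (hh.mono fun x hx => hx.symm)).trans_le (hN h)
  have hne : ∀ᵐ h : ℝ, h ≠ 0 := by simp [ae_iff]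
  calc ∫⁻ z, U z * (κ z * W z)
      = ∫⁻ z, hU.mk U z * (hκ.mk κ z * W z) := by
        refine lintegral_congr_ae ?_
        filter_upwards [hU.ae_eq_mk, hκ.ae_eq_mk] with z h1 h2
        rw [h1, h2]
    _ = ∫⁻ h : ℝ, ∫⁻ x : ℝ, hU.mk U (x, x + h) * (hκ.mk κ (x, x + h) * W (x, x + h)) :=
        lintegral_prod_eq_lintegral_shift
          (hU.measurable_mk.mul (hκ.measurable_mk.mul hW))
    _ ≤ ∫⁻ h : ℝ, N * ((ENNReal.ofReal |h| ^ (1 / q.toReal - -σ) *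
          lorentz p t fun x => hκ.mk κ (x, x + h)) *
          (ENNReal.ofReal |h| ^ (-(1 / q'.toReal) - s) * lorentz P t' fun x => W (x, x + h))) := by
        refine lintegral_mono_ae ?_
        filter_upwards [hU_ae, hne] with h h1 h2
        have h0 : ENNReal.ofReal |h| ≠ 0 := by simpa using h2
        have hcancel : ENNReal.ofReal |h| ^ (1 / q.toReal - -σ) *
            ENNReal.ofReal |h| ^ (-(1 / q'.toReal) - s) = 1 := by
          rw [hE.weight, ← ENNReal.rpow_add _ _ h0 ENNReal.ofReal_ne_top, add_neg_cancel,
            ENNReal.rpow_zero]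
        calc _ ≤ lorentz r ∞ (fun x => hU.mk U (x, x + h)) *
              (lorentz p t (fun x => hκ.mk κ (x, x + h)) * lorentz P t' fun x => W (x, x + h)) :=
              lintegral_mul_mul_le_lorentz hE.sum_inv hE.conj_t (hsec hU.measurable_mk h)
                (hsec hκ.measurable_mk h) (hsec hW h)
          _ ≤ N * ((ENNReal.ofReal |h| ^ (1 / q.toReal - -σ) *
              ENNReal.ofReal |h| ^ (-(1 / q'.toReal) - s)) *
              (lorentz p t (fun x => hκ.mk κ (x, x + h)) *
                lorentz P t' fun x => W (x, x + h))) := by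
              rw [hcancel, one_mul]
              gcongr
          _ = _ := by ring
    _ = N * ∫⁻ h : ℝ, (ENNReal.ofReal |h| ^ (1 / q.toReal - -σ) *
          lorentz p t fun x => hκ.mk κ (x, x + h)) *
          (ENNReal.ofReal |h| ^ (-(1 / q'.toReal) - s) * lorentz P t' fun x => W (x, x + h)) :=
        lintegral_const_mul _ (((hweight _).mul (hL _ hκ.measurable_mk _ _)).mul
          ((hweight _).mul (hL _ hW _ _)))
    _ ≤ N * (eLpNorm (fun h : ℝ => ENNReal.ofReal |h| ^ (1 / q.toReal - -σ) *
          lorentz p t fun x => hκ.mk κ (x, x + h)) q volume *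
        eLpNorm (fun h : ℝ => ENNReal.ofReal |h| ^ (-(1 / q'.toReal) - s) *
          lorentz P t' fun x => W (x, x + h)) q' volume) := by
        gcongr
        exact lintegral_mul_le_eLpNorm_mul_eLpNorm hE.conj_q
          ((hweight _).mul (hL _ hκ.measurable_mk _ _)).aemeasurable
          ((hweight _).mul (hL _ hW _ _)).aemeasurable
    _ = _ := by
        congr 2
        refine eLpNorm_congr_ae ?_
        filter_upwards [hκ_ae] with h hh
        rw [hh]

theorem lorentz_zero (p : ℝ) (t : ℝ≥0∞) : lorentz p t (fun _ => 0) = 0 := by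
  have : rearr (fun _ => (0 : ℝ≥0∞)) = 0 := by
    funext τ
    refine le_antisymm ((rearr_le_iff _ _ _).2 (by simp)) zero_le
  simp [lorentz, this]

/-- Where `|h| > ε`, the factor `min 1 |h|` is at least `min 1 ε`, so it can be inserted at the
price of a constant and the finiteness of `diffConst` applies. -/
theorem eLpNorm_truncated_weight_lt_top (hE : CompensationExponents r p P σ s t t' q q')
    {g : ℝ → ℝ≥0∞} (hg : lorentz P t' g < ∞) {ε : ℝ} (hε : 0 < ε) :
    eLpNorm (fun h : ℝ => ENNReal.ofReal |h| ^ (-(1 / q'.toReal) - s) *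
      lorentz P t' fun x => {z : ℝ × ℝ | ε < |z.1 - z.2|}.indicator (fun z => g z.1) (x, x + h))
      q' volume < ∞ := by
  set c := min 1 (ENNReal.ofReal ε) with hc
  have hc0 : c ≠ 0 := by simp [hc, hε]
  have hctop : c ≠ ∞ := by simp [hc]
  refine (eLpNorm_le_const_mul_eLpNorm (c := lorentz P t' g * c⁻¹)
    (g := fun h : ℝ => ENNReal.ofReal |h| ^ (-(1 / q'.toReal) - s) * min 1 (ENNReal.ofReal |h|))
    (ENNReal.mul_ne_top hg.ne (ENNReal.inv_ne_top.2 hc0))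
    (Eventually.of_forall fun h => ?_) q').trans_lt
    (ENNReal.mul_lt_top (ENNReal.mul_lt_top hg (ENNReal.inv_lt_top.2 hc0.bot_lt))
      (diffConst_lt_top hE.s_pos hE.s_lt_one hE.one_le_q' hE.q'_ne_top))
  by_cases hh : ε < |h|
  · have h1 : 1 ≤ c⁻¹ * min 1 (ENNReal.ofReal |h|) := by
      refine (ENNReal.inv_mul_cancel hc0 hctop).symm.trans_le (mul_le_mul_right ?_ _)
      exact min_le_min le_rfl (ENNReal.ofReal_le_ofReal hh.le)
    have h2 : (fun x => {z : ℝ × ℝ | ε < |z.1 - z.2|}.indicator (fun z => g z.1) (x, x + h)) = g := by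
      funext x
      simp [indicator, hh]
    rw [h2]
    calc _ = ENNReal.ofReal |h| ^ (-(1 / q'.toReal) - s) * lorentz P t' g * 1 := by rw [mul_one]
      _ ≤ ENNReal.ofReal |h| ^ (-(1 / q'.toReal) - s) * lorentz P t' g *
          (c⁻¹ * min 1 (ENNReal.ofReal |h|)) := by gcongr
      _ = _ := by ring
  · have h2 : (fun x => {z : ℝ × ℝ | ε < |z.1 - z.2|}.indicator (fun z => g z.1) (x, x + h)) =
        fun _ => 0 := by
      funext x
      simp [indicator, hh]
    rw [h2, lorentz_zero, mul_zero]
    exact zero_le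

theorem measurableSet_truncation (ε : ℝ) : MeasurableSet {z : ℝ × ℝ | ε < |z.1 - z.2|} :=
  measurableSet_lt measurable_const (measurable_norm.comp (measurable_fst.sub measurable_snd))

theorem integrableOn_truncation_of_le {E : Type*} [NormedAddCommGroup E]
    (hE : CompensationExponents r p P σ s t t' q q')
    {U κ : ℝ × ℝ → ℝ≥0∞} {g : ℝ → ℝ≥0∞} (hU : AEMeasurable U) (hκ : AEMeasurable κ)
    (hg : Measurable g) {N : ℝ≥0∞} (hN : N ≠ ∞)
    (hUN : ∀ h, lorentz r ∞ (fun x => U (x, x + h)) ≤ N)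
    (hκN : eLpNorm (fun h : ℝ => ENNReal.ofReal |h| ^ (1 / q.toReal - -σ) *
      lorentz p t fun x => κ (x, x + h)) q volume < ∞)
    (hgN : lorentz P t' g < ∞) {f : ℝ × ℝ → E} (hf : AEStronglyMeasurable f)
    (hle : ∀ z, ‖f z‖ₑ ≤ U z * (κ z * g z.1)) {ε : ℝ} (hε : 0 < ε) :
    IntegrableOn f {z : ℝ × ℝ | ε < |z.1 - z.2|} := by
  refine ⟨hf.restrict, ?_⟩
  have hD := measurableSet_truncation ε
  rw [hasFiniteIntegral_iff_enorm, ← lintegral_indicator hD]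
  have hW : Measurable ({z : ℝ × ℝ | ε < |z.1 - z.2|}.indicator fun z => g z.1) :=
    (hg.comp measurable_fst).indicator hD
  refine lt_of_le_of_lt (lintegral_mono fun z => ?_)
    ((lintegral_mul_kernel_le hE hU hκ hW hUN).trans_lt (ENNReal.mul_lt_top hN.lt_top
      (ENNReal.mul_lt_top hκN (eLpNorm_truncated_weight_lt_top hE hgN hε))))
  by_cases hz : z ∈ {z : ℝ × ℝ | ε < |z.1 - z.2|}
  · simpa only [indicator_of_mem hz] using hle z
  · simp only [indicator_of_notMem hz]
    exact zero_le

end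

/-! ### The multi-commutator -/

section

variable {m : ℕ}

theorem norm_toLp_mulVec_le (A : Mat m) (x : Vec m) :
    ‖(WithLp.toLp 2 (A *ᵥ x.ofLp) : Vec m)‖ ≤ ‖A‖ * ‖x‖ := by
  have h := Matrix.frobenius_norm_mul A (Matrix.replicateCol (Fin 1) x.ofLp)
  have hcol : ∀ u : Fin m → ℝ, ‖Matrix.replicateCol (Fin 1) u‖ = ‖(WithLp.toLp 2 u : Vec m)‖ :=
    fun u => Matrix.frobenius_norm_replicateCol u
  rwa [← Matrix.replicateCol_mulVec, hcol, hcol] at h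

theorem enorm_toLp_mulVec_le (A : Mat m) (x : Vec m) :
    ‖(WithLp.toLp 2 (A *ᵥ x.ofLp) : Vec m)‖ₑ ≤ ‖A‖ₑ * ‖x‖ₑ := by
  rw [← ofReal_norm, ← ofReal_norm, ← ofReal_norm, ← ENNReal.ofReal_mul (norm_nonneg _)]
  exact ENNReal.ofReal_le_ofReal (norm_toLp_mulVec_le A x)

theorem enorm_transpose (A : Mat m) : ‖Aᵀ‖ₑ = ‖A‖ₑ := by
  rw [← ofReal_norm, ← ofReal_norm, Matrix.frobenius_norm_transpose]

theorem enorm_inner_le_mul (x y : Vec m) : ‖(inner ℝ x y : ℝ)‖ₑ ≤ ‖x‖ₑ * ‖y‖ₑ := by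
  rw [← ofReal_norm, ← ofReal_norm, ← ofReal_norm, ← ENNReal.ofReal_mul (norm_nonneg _)]
  exact ENNReal.ofReal_le_ofReal (norm_inner_le_norm x y)

theorem aemeasurable_enorm_of_entries {κ : ℝ × ℝ → Mat m}
    (h : ∀ i j, AEStronglyMeasurable fun z => κ z i j) : AEMeasurable fun z => ‖κ z‖ₑ := by
  have h1 : AEMeasurable fun z => ‖κ z‖ := by
    simp only [Matrix.frobenius_norm_def]
    refine AEMeasurable.pow_const (Finset.aemeasurable_fun_sum _ fun i _ =>
      Finset.aemeasurable_fun_sum _ fun j _ => ?_) _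
    exact (h i j).norm.aemeasurable.pow_const _
  simpa only [ofReal_norm] using h1.ennreal_ofReal

theorem aestronglyMeasurable_toLp_mulVec {κ : ℝ × ℝ → Mat m} {u : ℝ × ℝ → Vec m}
    (h : ∀ i j, AEStronglyMeasurable fun z => κ z i j) (hu : AEStronglyMeasurable u) :
    AEStronglyMeasurable fun z => (WithLp.toLp 2 (κ z *ᵥ (u z).ofLp) : Vec m) := by
  refine (PiLp.continuous_toLp 2 _).comp_aestronglyMeasurable
    (aemeasurable_pi_lambda _ fun i => ?_).aestronglyMeasurable
  refine Finset.aemeasurable_fun_sum (f := fun j z => κ z i j * (u z).ofLp j) Finset.univ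
    fun j _ => (h i j).aemeasurable.mul ?_
  exact ((EuclideanSpace.proj (𝕜 := ℝ) j).continuous.comp_aestronglyMeasurable hu).aemeasurable

variable {K : ℝ → ℝ → Mat m} {v : ℝ → Vec m} {r p P σ s : ℝ} {t t' q q' : ℝ≥0∞}

/-- The compensated bilinear integrand of the multi-commutator. -/
noncomputable def compensatedPairing (K : ℝ → ℝ → Mat m) (v : ℝ → Vec m) (φ : ℝ → Vec m) (z : ℝ × ℝ) : ℝ :=
  inner ℝ (φ z.1 - φ z.2) (WithLp.toLp 2 ((K z.1 z.2)ᵀ *ᵥ (v z.1).ofLp) : Vec m)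

theorem kernelNorm_eq (σ p : ℝ) (t q : ℝ≥0∞) (K : ℝ → ℝ → Mat m) :
    kernelNorm σ p t q K = eLpNorm (fun h : ℝ => ENNReal.ofReal |h| ^ (1 / q.toReal - σ) *
      lorentz p t fun x => (fun z : ℝ × ℝ => ‖K z.1 z.2‖ₑ) (x, x + h)) q volume := rfl

/-- Serves three purposes: integrability of the compensated integrand, continuity of the resulting
functional, and the final norm bound. -/
theorem lintegral_compensatedPairing_le (hE : CompensationExponents r p P σ s t t' q q')
    (hK : ∀ i j, AEStronglyMeasurable fun z : ℝ × ℝ => K z.1 z.2 i j)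
    (hv : AEStronglyMeasurable v) (φ : 𝓢(ℝ, Vec m)) :
    ∫⁻ z, ‖compensatedPairing K v φ z‖ₑ ≤ kernelNorm (-σ) p t q K * lorentzNorm r ∞ v *
      besovNorm s P t' q' (fun x => φ x) := by
  have hW : Measurable fun z : ℝ × ℝ => ‖φ z.1 - φ z.2‖ₑ :=
    ((φ.continuous.comp continuous_fst).sub (φ.continuous.comp continuous_snd)).enorm.measurable
  have hU : AEMeasurable fun z : ℝ × ℝ => ‖v z.1‖ₑ :=
    (hv.enorm.comp_quasiMeasurePreserving Measure.quasiMeasurePreserving_fst)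
  have key := lintegral_mul_kernel_le hE hU (aemeasurable_enorm_of_entries hK) hW
    (N := lorentzNorm r ∞ v) (fun _ => le_rfl)
  rw [← kernelNorm_eq (-σ) p t q K] at key
  refine le_trans (lintegral_mono fun z => ?_) (key.trans_eq ?_)
  · refine (enorm_inner_le_mul _ _).trans ?_
    calc ‖φ z.1 - φ z.2‖ₑ * ‖(WithLp.toLp 2 ((K z.1 z.2)ᵀ *ᵥ (v z.1).ofLp) : Vec m)‖ₑ
        ≤ ‖φ z.1 - φ z.2‖ₑ * (‖K z.1 z.2‖ₑ * ‖v z.1‖ₑ) := by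
          rw [← enorm_transpose (K z.1 z.2)]
          gcongr
          exact enorm_toLp_mulVec_le _ _
      _ = _ := by ring
  · have : besovNorm s P t' q' (fun x => φ x) =
        eLpNorm (fun h : ℝ => ENNReal.ofReal |h| ^ (-(1 / q'.toReal) - s) *
          lorentz P t' fun x => ‖φ x - φ (x + h)‖ₑ) q' volume := by
      simp only [besovNorm, lorentzNorm_eq_lorentz, enorm_sub_rev]
    rw [this]
    ring

theorem aestronglyMeasurable_compensatedPairing
    (hK : ∀ i j, AEStronglyMeasurable fun z : ℝ × ℝ => K z.1 z.2 i j)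
    (hv : AEStronglyMeasurable v) (φ : 𝓢(ℝ, Vec m)) :
    AEStronglyMeasurable (compensatedPairing K v φ) := by
  have hφ : Continuous fun z : ℝ × ℝ => φ z.1 - φ z.2 :=
    (φ.continuous.comp continuous_fst).sub (φ.continuous.comp continuous_snd)
  exact hφ.aestronglyMeasurable.inner (aestronglyMeasurable_toLp_mulVec
    (κ := fun z => (K z.1 z.2)ᵀ) (u := fun z => v z.1) (fun i j => hK j i)
    (hv.comp_quasiMeasurePreserving Measure.quasiMeasurePreserving_fst))

theorem besovNorm_schwartz_lt_top (hE : CompensationExponents r p P σ s t t' q q')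
    (φ : 𝓢(ℝ, Vec m)) : besovNorm s P t' q' (fun x => φ x) < ∞ := by
  have hc := cutoffConst_lt_top hE.one_lt hE.one_le_t'
  exact (besovNorm_schwartz_le s P t' q' hc.ne φ).trans_lt (ENNReal.mul_lt_top
    (ENNReal.mul_lt_top ENNReal.ofReal_lt_top hc)
    (diffConst_lt_top hE.s_pos hE.s_lt_one hE.one_le_q' hE.q'_ne_top))

theorem integrable_compensatedPairing (hE : CompensationExponents r p P σ s t t' q q')
    (hK : ∀ i j, AEStronglyMeasurable fun z : ℝ × ℝ => K z.1 z.2 i j)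
    (hv : AEStronglyMeasurable v) (hKN : kernelNorm (-σ) p t q K < ∞)
    (hvN : lorentzNorm r ∞ v < ∞) (φ : 𝓢(ℝ, Vec m)) :
    Integrable (compensatedPairing K v φ) := by
  refine ⟨aestronglyMeasurable_compensatedPairing hK hv φ, ?_⟩
  exact (lintegral_compensatedPairing_le hE hK hv φ).trans_lt
    (ENNReal.mul_lt_top (ENNReal.mul_lt_top hKN hvN) (besovNorm_schwartz_lt_top hE φ))

/-- The multi-commutator as a tempered distribution. -/
noncomputable def multicommutator (hE : CompensationExponents r p P σ s t t' q q')
    (hK : ∀ i j, AEStronglyMeasurable fun z : ℝ × ℝ => K z.1 z.2 i j)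
    (hv : AEStronglyMeasurable v) (hKN : kernelNorm (-σ) p t q K < ∞)
    (hvN : lorentzNorm r ∞ v < ∞) : 𝓢(ℝ, Vec m) →L[ℝ] ℝ :=
  SchwartzMap.mkCLMtoNormedSpace (fun φ => ∫ z, compensatedPairing K v φ z)
    (fun φ ψ => by
      rw [← integral_add (integrable_compensatedPairing hE hK hv hKN hvN φ)
        (integrable_compensatedPairing hE hK hv hKN hvN ψ)]
      refine integral_congr_ae (Eventually.of_forall fun z => ?_)
      simp only [compensatedPairing, add_apply]
      rw [← inner_add_left]
      congr 1
      abel)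
    (fun a φ => by
      rw [RingHom.id_apply, smul_eq_mul, ← integral_const_mul]
      refine integral_congr_ae (Eventually.of_forall fun z => ?_)
      simp only [compensatedPairing, smul_apply]
      rw [← smul_sub, real_inner_smul_left])
    (by
      have hc := cutoffConst_lt_top hE.one_lt hE.one_le_t'
      have hd := diffConst_lt_top hE.s_pos hE.s_lt_one hE.one_le_q' hE.q'_ne_top
      set A := kernelNorm (-σ) p t q K * lorentzNorm r ∞ v * cutoffConst P t' * diffConst s q'
        with hA
      have hAtop : A ≠ ∞ := (ENNReal.mul_lt_top (ENNReal.mul_lt_top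
        (ENNReal.mul_lt_top hKN hvN) hc) hd).ne
      refine ⟨Finset.Iic (2, 1), 64 * A.toReal, by positivity, fun φ => ?_⟩
      change _ ≤ _ * decaySeminorm (Vec m) φ
      have hS : 0 ≤ decaySeminorm (Vec m) φ := apply_nonneg _ _
      have h1 := (enorm_integral_le_lintegral_enorm (compensatedPairing K v φ)).trans
        ((lintegral_compensatedPairing_le hE hK hv φ).trans
          (mul_le_mul_right (besovNorm_schwartz_le s P t' q' hc.ne φ) _))
      have h2 : kernelNorm (-σ) p t q K * lorentzNorm r ∞ v *
          (ENNReal.ofReal (64 * decaySeminorm (Vec m) φ) * cutoffConst P t' * diffConst s q') =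
          ENNReal.ofReal (64 * A.toReal * decaySeminorm (Vec m) φ) := by
        rw [mul_right_comm 64, ENNReal.ofReal_mul' ENNReal.toReal_nonneg,
          ENNReal.ofReal_toReal hAtop, hA]
        ring
      rw [h2, ← ofReal_norm] at h1
      exact (ENNReal.ofReal_le_ofReal_iff (by positivity)).1 h1)

theorem multicommutator_apply (hE : CompensationExponents r p P σ s t t' q q')
    (hK : ∀ i j, AEStronglyMeasurable fun z : ℝ × ℝ => K z.1 z.2 i j)
    (hv : AEStronglyMeasurable v) (hKN : kernelNorm (-σ) p t q K < ∞)
    (hvN : lorentzNorm r ∞ v < ∞) (φ : 𝓢(ℝ, Vec m)) :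
    multicommutator hE hK hv hKN hvN φ = ∫ z, compensatedPairing K v φ z := rfl

theorem integrableOn_truncation_weight (hE : CompensationExponents r p P σ s t t' q q')
    (hK : ∀ i j, AEStronglyMeasurable fun z : ℝ × ℝ => K z.1 z.2 i j)
    (hv : AEStronglyMeasurable v) (hKN : kernelNorm (-σ) p t q K < ∞)
    (hvN : lorentzNorm r ∞ v < ∞) {E : Type*} [NormedAddCommGroup E] {g : ℝ → ℝ≥0∞}
    (hg : Measurable g) (hgN : lorentz P t' g < ∞) {f₁ f₂ : ℝ × ℝ → E}
    (hf₁ : AEStronglyMeasurable f₁) (hf₂ : AEStronglyMeasurable f₂)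
    (h₁ : ∀ z, ‖f₁ z‖ₑ ≤ ‖v z.1‖ₑ * (‖K z.1 z.2‖ₑ * g z.1))
    (h₂ : ∀ z, ‖f₂ z‖ₑ ≤ ‖v z.2‖ₑ * (‖K z.1 z.2‖ₑ * g z.1)) {ε : ℝ} (hε : 0 < ε) :
    IntegrableOn f₁ {z : ℝ × ℝ | ε < |z.1 - z.2|} ∧
      IntegrableOn f₂ {z : ℝ × ℝ | ε < |z.1 - z.2|} :=
  ⟨integrableOn_truncation_of_le hE
    (hv.enorm.comp_quasiMeasurePreserving Measure.quasiMeasurePreserving_fst)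
    (aemeasurable_enorm_of_entries hK) hg hvN.ne (fun _ => le_rfl) hKN hgN hf₁ h₁ hε,
  integrableOn_truncation_of_le hE
    (hv.enorm.comp_quasiMeasurePreserving Measure.quasiMeasurePreserving_snd)
    (aemeasurable_enorm_of_entries hK) hg hvN.ne
    (fun h => (lorentz_comp_add_right r ∞ (fun x => ‖v x‖ₑ) h).le) hKN hgN hf₂ h₂ hε⟩

/-! ### Truncated integrals and their principal-value limit. -/

theorem multiIntegrand_eq_add (K : ℝ → ℝ → Mat m) (v : ℝ → Vec m) (x y : ℝ) :
    multiIntegrand K v x y = (WithLp.toLp 2 ((K x y)ᵀ *ᵥ (v x).ofLp) : Vec m) +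
      (WithLp.toLp 2 (K x y *ᵥ (v y).ofLp) : Vec m) := rfl

theorem truncation_indicator_eq {E : Type*} [Zero E] (F : ℝ × ℝ → E) (ε x : ℝ) :
    (fun y => {z : ℝ × ℝ | ε < |z.1 - z.2|}.indicator F (x, y)) =
      {y : ℝ | ε < |x - y|}.indicator fun y => F (x, y) := rfl

/-- The weight `(1 + x²)⁻¹` lies in `L^{P,t'}`, so the weighted integrand is integrable on the plane
off the diagonal strip. Fubini gives almost every `x`, and the nonzero weight is then divided out.
-/
theorem ae_integrableOn_multiIntegrand (hE : CompensationExponents r p P σ s t t' q q')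
    (hK : ∀ i j, AEStronglyMeasurable fun z : ℝ × ℝ => K z.1 z.2 i j)
    (hv : AEStronglyMeasurable v) (hKN : kernelNorm (-σ) p t q K < ∞)
    (hvN : lorentzNorm r ∞ v < ∞) {ε : ℝ} (hε : 0 < ε) :
    ∀ᵐ x : ℝ, IntegrableOn (fun y => multiIntegrand K v x y) {y : ℝ | ε < |x - y|} := by
  have hw : Continuous fun x : ℝ => (1 + x ^ 2)⁻¹ :=
    Continuous.inv₀ (by fun_prop) fun x => by positivity
  have hgm : Measurable fun x : ℝ => ‖(1 + x ^ 2)⁻¹‖ₑ := hw.enorm.measurable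
  have hgN : lorentz P t' (fun x : ℝ => ‖(1 + x ^ 2)⁻¹‖ₑ) < ∞ :=
    (lorentz_le_of_le_inv_one_add_sq hgm zero_le_one (fun x => by
      rw [one_mul, Real.enorm_of_nonneg (by positivity)]) P t').trans_lt
      (ENNReal.mul_lt_top ENNReal.ofReal_lt_top (cutoffConst_lt_top hE.one_lt hE.one_le_t'))
  have hwm : AEStronglyMeasurable fun z : ℝ × ℝ => (1 + z.1 ^ 2)⁻¹ :=
    (hw.comp continuous_fst).aestronglyMeasurable
  have hv₁ : AEStronglyMeasurable fun z : ℝ × ℝ => v z.1 :=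
    hv.comp_quasiMeasurePreserving Measure.quasiMeasurePreserving_fst
  have hv₂ : AEStronglyMeasurable fun z : ℝ × ℝ => v z.2 :=
    hv.comp_quasiMeasurePreserving Measure.quasiMeasurePreserving_snd
  obtain ⟨i₁, i₂⟩ := integrableOn_truncation_weight hE hK hv hKN hvN hgm hgN
    (f₁ := fun z => (1 + z.1 ^ 2)⁻¹ • (WithLp.toLp 2 ((K z.1 z.2)ᵀ *ᵥ (v z.1).ofLp) : Vec m))
    (f₂ := fun z => (1 + z.1 ^ 2)⁻¹ • (WithLp.toLp 2 (K z.1 z.2 *ᵥ (v z.2).ofLp) : Vec m))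
    (hwm.smul (aestronglyMeasurable_toLp_mulVec (κ := fun z => (K z.1 z.2)ᵀ)
      (fun i j => hK j i) hv₁))
    (hwm.smul (aestronglyMeasurable_toLp_mulVec (κ := fun z => K z.1 z.2) hK hv₂))
    (fun z => by
      rw [enorm_smul, mul_comm, ← mul_assoc, mul_comm ‖v z.1‖ₑ, ← enorm_transpose (K z.1 z.2)]
      gcongr
      exact enorm_toLp_mulVec_le _ _)
    (fun z => by
      rw [enorm_smul, mul_comm, ← mul_assoc, mul_comm ‖v z.2‖ₑ]
      gcongr
      exact enorm_toLp_mulVec_le _ _) hε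
  have hi := (integrable_indicator_iff (measurableSet_truncation ε)).2 (i₁.add i₂)
  rw [Measure.volume_eq_prod] at hi
  filter_upwards [hi.prod_right_ae] with x hx
  have hset : MeasurableSet {y : ℝ | ε < |x - y|} :=
    (measurableSet_truncation ε).preimage measurable_prodMk_left
  rw [truncation_indicator_eq, integrable_indicator_iff hset] at hx
  have hx0 : (1 + x ^ 2)⁻¹ ≠ (0 : ℝ) := by positivity
  refine (integrable_smul_iff hx0 _).1 (hx.congr (Eventually.of_forall fun y => ?_))
  simp only [Pi.add_apply, Pi.smul_apply, multiIntegrand_eq_add, smul_add]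

/-- The symmetrization. Off the diagonal strip both terms are separately integrable, so Fubini
applies and the variables may be exchanged in one of them alone. -/
theorem integrable_inner_multiTrunc_and_integral_eq
    (hE : CompensationExponents r p P σ s t t' q q')
    (hK : ∀ i j, AEStronglyMeasurable fun z : ℝ × ℝ => K z.1 z.2 i j)
    (hanti : AntiSelfDual K)
    (hv : AEStronglyMeasurable v) (hKN : kernelNorm (-σ) p t q K < ∞)
    (hvN : lorentzNorm r ∞ v < ∞) (φ : 𝓢(ℝ, Vec m)) {ε : ℝ} (hε : 0 < ε) :
    Integrable (fun x : ℝ => inner ℝ (φ x) (multiTrunc K v ε x)) ∧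
      ∫ x : ℝ, inner ℝ (φ x) (multiTrunc K v ε x) =
        ∫ z in {z : ℝ × ℝ | ε < |z.1 - z.2|}, compensatedPairing K v φ z := by
  have hgN : lorentz P t' (fun x => ‖φ x‖ₑ) < ∞ := (lorentz_schwartz_le φ P t').trans_lt
    (ENNReal.mul_lt_top ENNReal.ofReal_lt_top (cutoffConst_lt_top hE.one_lt hE.one_le_t'))
  have hφ : AEStronglyMeasurable fun z : ℝ × ℝ => φ z.1 :=
    (φ.continuous.comp continuous_fst).aestronglyMeasurable
  have hv₁ : AEStronglyMeasurable fun z : ℝ × ℝ => v z.1 :=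
    hv.comp_quasiMeasurePreserving Measure.quasiMeasurePreserving_fst
  have hv₂ : AEStronglyMeasurable fun z : ℝ × ℝ => v z.2 :=
    hv.comp_quasiMeasurePreserving Measure.quasiMeasurePreserving_snd
  set f₁ : ℝ × ℝ → ℝ := fun z =>
    inner ℝ (φ z.1) (WithLp.toLp 2 ((K z.1 z.2)ᵀ *ᵥ (v z.1).ofLp) : Vec m) with hf₁
  set f₂ : ℝ × ℝ → ℝ := fun z =>
    inner ℝ (φ z.1) (WithLp.toLp 2 (K z.1 z.2 *ᵥ (v z.2).ofLp) : Vec m) with hf₂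
  set D : Set (ℝ × ℝ) := {z : ℝ × ℝ | ε < |z.1 - z.2|} with hD
  have hDm : MeasurableSet D := measurableSet_truncation ε
  obtain ⟨i₁, i₂⟩ := integrableOn_truncation_weight hE hK hv hKN hvN
    φ.continuous.enorm.measurable hgN (f₁ := f₁) (f₂ := f₂)
    (hφ.inner (aestronglyMeasurable_toLp_mulVec (κ := fun z => (K z.1 z.2)ᵀ)
      (fun i j => hK j i) hv₁))
    (hφ.inner (aestronglyMeasurable_toLp_mulVec (κ := fun z => K z.1 z.2) hK hv₂))
    (fun z => by
      refine (enorm_inner_le_mul _ _).trans ?_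
      rw [mul_comm, ← mul_assoc, mul_comm ‖v z.1‖ₑ, ← enorm_transpose (K z.1 z.2)]
      gcongr
      exact enorm_toLp_mulVec_le _ _)
    (fun z => by
      refine (enorm_inner_le_mul _ _).trans ?_
      rw [mul_comm, ← mul_assoc, mul_comm ‖v z.2‖ₑ]
      gcongr
      exact enorm_toLp_mulVec_le _ _) hε
  have hi := (integrable_indicator_iff hDm).2 (i₁.add i₂)
  rw [Measure.volume_eq_prod] at hi
  have hslice : (fun x => ∫ y, D.indicator (f₁ + f₂) (x, y)) =ᵐ[volume]
      fun x => inner ℝ (φ x) (multiTrunc K v ε x) := by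
    filter_upwards [ae_integrableOn_multiIntegrand hE hK hv hKN hvN hε] with x hx
    have hset : MeasurableSet {y : ℝ | ε < |x - y|} := hDm.preimage measurable_prodMk_left
    rw [hD, truncation_indicator_eq, integral_indicator hset, multiTrunc, ← integral_inner hx]
    refine integral_congr_ae (Eventually.of_forall fun y => ?_)
    simp only [Pi.add_apply, hf₁, hf₂, multiIntegrand_eq_add, inner_add_right]
  refine ⟨hi.integral_prod_left.congr hslice, ?_⟩
  rw [← integral_congr_ae hslice, ← integral_prod _ hi, ← Measure.volume_eq_prod,
    integral_indicator hDm]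
  simp only [Pi.add_apply]
  rw [integral_add i₁ i₂, ← integral_indicator hDm (f := f₂)]
  -- The truncation region is symmetric under exchange of the variables.
  have hswap : ∫ z, D.indicator f₂ z = ∫ z in D, f₂ z.swap := by
    rw [Measure.volume_eq_prod, ← integral_prod_swap, ← integral_indicator hDm]
    refine integral_congr_ae (Eventually.of_forall fun z => ?_)
    have : z.swap ∈ D ↔ z ∈ D := by simp [hD, abs_sub_comm]
    by_cases hz : z ∈ D
    · simp only [indicator_of_mem hz, indicator_of_mem (this.2 hz)]
    · simp only [indicator_of_notMem hz, indicator_of_notMem (mt this.1 hz)]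
  have i₂' : IntegrableOn (fun z => f₂ z.swap) D := by
    rw [← integrable_indicator_iff hDm]
    have := ((integrable_indicator_iff hDm).2 i₂)
    rw [Measure.volume_eq_prod] at this
    refine this.swap.congr (Eventually.of_forall fun z => ?_)
    have hzs : z.swap ∈ D ↔ z ∈ D := by simp [hD, abs_sub_comm]
    by_cases hz : z ∈ D
    · simp only [Function.comp_apply, indicator_of_mem hz, indicator_of_mem (hzs.2 hz)]
    · simp only [Function.comp_apply, indicator_of_notMem hz, indicator_of_notMem (mt hzs.1 hz)]
  rw [hswap, ← integral_add i₁ i₂']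
  refine integral_congr_ae (ae_restrict_of_ae ?_)
  filter_upwards [hanti] with z hz
  -- The swapped kernel becomes `-Kᵗ(x,y)`, which produces the difference `φ(x) - φ(y)`.
  have hz' : K z.2 z.1 = -(K z.1 z.2)ᵀ := by
    rw [hz, Matrix.transpose_neg, Matrix.transpose_transpose, neg_neg]
  simp only [hf₁, hf₂, compensatedPairing, Prod.fst_swap, Prod.snd_swap, hz', Matrix.neg_mulVec,
    WithLp.toLp_neg, inner_neg_right, inner_sub_left]
  ring

/-- Dominated convergence: the diagonal is null, and off it the indicator is eventually 1. -/
theorem tendsto_setIntegral_truncation {f : ℝ × ℝ → ℝ} (hf : Integrable f) :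
    Tendsto (fun ε : ℝ => ∫ z in {z : ℝ × ℝ | ε < |z.1 - z.2|}, f z) (𝓝[>] 0) (𝓝 (∫ z, f z)) := by
  have hdiag : ∀ᵐ z : ℝ × ℝ, z.1 ≠ z.2 := by
    rw [Measure.volume_eq_prod]
    refine (Measure.ae_prod_iff_ae_ae ?_).2 (Eventually.of_forall fun x => ?_)
    · exact (measurableSet_eq_fun measurable_fst measurable_snd).compl
    · simp [ae_iff]
  simp only [← integral_indicator (measurableSet_truncation _)]
  refine tendsto_integral_filter_of_dominated_convergence (fun z => ‖f z‖)
    (Eventually.of_forall fun ε => hf.1.indicator (measurableSet_truncation ε))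
    (Eventually.of_forall fun ε => Eventually.of_forall fun z => norm_indicator_le_norm_self _ _)
    hf.norm ?_
  filter_upwards [hdiag] with z hz
  refine tendsto_const_nhds.congr' ?_
  have hpos : 0 < |z.1 - z.2| := abs_pos.2 (sub_ne_zero.2 hz)
  filter_upwards [nhdsWithin_le_nhds (eventually_lt_nhds hpos)] with ε hε
  rw [indicator_of_mem]
  exact hε

theorem isMulticommutator_multicommutator (hE : CompensationExponents r p P σ s t t' q q')
    (hK : ∀ i j, AEStronglyMeasurable fun z : ℝ × ℝ => K z.1 z.2 i j) (hanti : AntiSelfDual K)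
    (hv : AEStronglyMeasurable v) (hKN : kernelNorm (-σ) p t q K < ∞)
    (hvN : lorentzNorm r ∞ v < ∞) :
    IsMulticommutator K v (multicommutator hE hK hv hKN hvN) := by
  refine ⟨fun ε hε => ⟨ae_integrableOn_multiIntegrand hE hK hv hKN hvN hε, fun φ =>
    (integrable_inner_multiTrunc_and_integral_eq hE hK hanti hv hKN hvN φ hε).1⟩, fun φ => ?_⟩
  rw [multicommutator_apply]
  refine (tendsto_setIntegral_truncation
    (integrable_compensatedPairing hE hK hv hKN hvN φ)).congr' ?_
  filter_upwards [self_mem_nhdsWithin] with ε hε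
  exact (integrable_inner_multiTrunc_and_integral_eq hE hK hanti hv hKN hvN φ hε).2.symm

end

/-! ### Exponent arithmetic and conclusion. -/

theorem compensationExponents_of_conj {r p σ : ℝ} {q t : ℝ≥0∞} (hr : 1 < r)
    (hp : Real.conjExponent r < p) (hq : 2 ≤ q) (ht : 1 ≤ t)
    (hs0 : 0 < 2 / q.toReal - 1 + σ) (hs1 : 2 / q.toReal - 1 + σ < 1) :
    CompensationExponents r p (Real.conjExponent (r * p / (p + r))) σ (2 / q.toReal - 1 + σ)
      t (ENNReal.conjExponent t) q (ENNReal.conjExponent q) := by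
  have hq1 : 1 ≤ q := one_le_two.trans hq
  have hcq := ENNReal.HolderConjugate.conjExponent hq1
  have hct := ENNReal.HolderConjugate.conjExponent ht
  have hr0 : 0 < r := by linarith
  have hrp : r < p * (r - 1) := by
    rwa [Real.conjExponent, div_lt_iff₀ (by linarith)] at hp
  have hp0 : 0 < p := by nlinarith
  -- This is where `p > r'` enters: it says that `1/r + 1/p < 1`.
  have hP : 1 < r * p / (p + r) := by
    rw [lt_div_iff₀ (by positivity)]
    nlinarith
  have hcP := Real.HolderConjugate.conjExponent hP
  have hq' : ENNReal.conjExponent q ≠ ∞ := by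
    rw [ENNReal.conjExponent]
    refine ENNReal.add_ne_top.2 ⟨by simp, ENNReal.inv_ne_top.2 ?_⟩
    exact (tsub_pos_of_lt (lt_of_lt_of_le (by norm_num) hq)).ne'
  have hinv : 1 / q.toReal + 1 / (ENNReal.conjExponent q).toReal = 1 := by
    have h := congrArg ENNReal.toReal hcq.inv_add_inv_eq_inv
    rw [ENNReal.toReal_add (ENNReal.inv_ne_top.2 (zero_lt_one.trans_le hq1).ne')
      (ENNReal.inv_ne_top.2 (by simp [ENNReal.conjExponent]))] at h
    simpa [ENNReal.toReal_inv] using h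
  refine ⟨?_, hcP.symm.lt, hct, hcq, ?_, hs0, hs1, by simp [ENNReal.conjExponent],
    by simp [ENNReal.conjExponent], hq'⟩
  · have h := hcP.inv_add_inv_eq_one
    have h3 : (r * p / (p + r))⁻¹ = 1 / r + 1 / p := by field_simp
    rwa [h3, ← one_div] at h
  -- With `1/q' = 1 - 1/q`, the exponent `-1/q' - s` equals `-1/q - σ`; for `q = ∞` the value `1 /
  -- q.toReal = 0` is the right convention.
  · have h2 : 2 / q.toReal = 2 * (1 / q.toReal) := by ring
    rw [h2]
    linarith

theorem mainTheorem9 (r p σ : ℝ) (q t : ℝ≥0∞)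
    (hr : 1 < r) (hp : Real.conjExponent r < p) (hq : 2 ≤ q) (hσ : 0 < σ) (ht : 1 ≤ t)
    (hs0 : 0 < 2 / q.toReal - 1 + σ) (hs1 : 2 / q.toReal - 1 + σ < 1) :
    ∃ C : ℝ≥0, ∀ (m : ℕ) (K : ℝ → ℝ → Mat m) (v : ℝ → Vec m),
      (∀ i j, LocallyIntegrable (fun z : ℝ × ℝ => K z.1 z.2 i j)) →
      AntiSelfDual K →
      kernelNorm (-σ) p t q K < ∞ →
      AEStronglyMeasurable v →
      lorentzNorm r ∞ v < ∞ →
      ∃ T : 𝓢(ℝ, Vec m) →L[ℝ] ℝ, IsMulticommutator K v T ∧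
        besovNegNorm (2 / q.toReal - 1 + σ) (r * p / (p + r)) t q T ≤
          C * kernelNorm (-σ) p t q K * lorentzNorm r ∞ v := by
  -- Every Hölder inequality used has constant 1, and the Frobenius norm dominates the operator
  -- norm, so `C = 1` works in all dimensions.
  refine ⟨1, fun m K v hK hanti hKN hv hvN => ?_⟩
  have hE := compensationExponents_of_conj hr hp hq ht hs0 hs1
  have hK' : ∀ i j, AEStronglyMeasurable fun z : ℝ × ℝ => K z.1 z.2 i j := fun i j =>
    (hK i j).aestronglyMeasurable
  refine ⟨multicommutator hE hK' hv hKN hvN,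
    isMulticommutator_multicommutator hE hK' hanti hv hKN hvN, iSup₂_le fun φ hφ => ?_⟩
  rw [multicommutator_apply, ENNReal.coe_one, one_mul]
  refine (enorm_integral_le_lintegral_enorm _).trans
    ((lintegral_compensatedPairing_le hE hK' hv φ).trans ?_)
  calc _ ≤ kernelNorm (-σ) p t q K * lorentzNorm r ∞ v * 1 := by gcongr
    _ = _ := mul_one _
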